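/- Let $\mathbb{F}$ be a finite field with $q$ elements and characteristic $p$, let $A=\mathbb{F}[T]$ and $K=\mathbb{F}(T)$, let $K_\infty=\mathbb{F}((T^{-1}))$ be the completion of $K$ at infinity with the absolute value normalized by $|T|=q$, and let $C$ be the completed algebraic closure of $K_\infty$. Let $L\subset C$ be a finite extension of $K_\infty$, and let $\phi$ be a Drinfeld $A$-module of rank $r\ge 2$ over $L$, given by $$\phi_T(X)=TX+g_1X^q+\dots+g_rX^{q^r},\qquad g_1,\dots,g_r\in L,\ g_r\neq 0.$$ Let $\Lambda$ be its period lattice, i.e. the discrete free $A$-submodule of $C$ of rank $r$ such that $e_\Lambda(Tz)=\phi_T(e_\Lambda(z))$ for all $z\in C$, where $e_\Lambda(z)=z\prod_{0\ne\lambda\in\Lambda}(1-z/\lambda)$. Let $\{\lambda_1,\dots,\lambda_r\}$ be a successive minimum basis of $\Lambda$: for each $i$, $\lambda_i$ has minimal absolute value among the elements of $\Lambda\smallsetminus\sum_{j<i}A\lambda_j$. Split it into packets $\mathbf{B}_1,\dots,\mathbf{B}_t$ of vectors of equal absolute value, ordered by that value, strictly increasing from packet to packet, and let $r_\tau=\#\mathbf{B}_\tau\ge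 1$, so that $\sum_\tau r_\tau=r$. Then the field $L(\Lambda)\subset C$ generated by $\Lambda$ over $L$ is a finite extension of $L$, and its residue class degree satisfies $$f(L(\Lambda)|L)\ \le\ \prod_{1\le\tau\le t}(q^{r_\tau}-1)\cdot p^{t-1}.$$ In particular, $$f(L(\Lambda)|L)\ \le\ (q^r-1)\,p^{t-1}\ \le\ (q^r-1)\,p^{r-1},$$ so that, for given $\mathbb{F}$, the residue class degree is bounded in terms of $r$ alone. -/

import Mathlib

open scoped Polynomial NNReal WithZero

noncomputable section

namespace DrinfeldPeriods

/-! ### The field `K_∞ = 𝔽((T⁻¹))` with `|T| = q` -/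

section KInfty

variable (F : Type*) [Field F]

/-- `K_∞`: the completion of `K = 𝔽(T)` at the place at infinity. -/
abbrev KInfty : Type _ := @RatFunc.CompletionAtInfty F _ (Classical.decEq _)

instance : CompleteSpace (KInfty F) := by
  let _ : DecidableEq (RatFunc F) := Classical.decEq _
  let _ : UniformSpace (RatFunc F) := (RatFunc.inftyValued F).toUniformSpace
  exact inferInstanceAs (CompleteSpace (UniformSpace.Completion (RatFunc F)))

/-- `K_∞` as an algebra over `A = 𝔽[T]`, through `A ⊆ K ⊆ K_∞`. -/
instance : Algebra F[X] (KInfty F) :=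
  ((algebraMap (RatFunc F) (KInfty F)).comp (algebraMap F[X] (RatFunc F))).toAlgebra

/-- The element `T` of `K_∞`. -/
def T : KInfty F := algebraMap F[X] (KInfty F) Polynomial.X

theorem v_T : Valued.v (T F) = (WithZero.exp (1 : ℤ) : ℤᵐ⁰) := by
  let _ : DecidableEq (RatFunc F) := Classical.decEq _
  have h : (RatFunc.inftyValued F).v (RatFunc.X : RatFunc F) = (WithZero.exp (1 : ℤ) : ℤᵐ⁰) :=
    RatFunc.inftyValuation.X F
  rw [← h, T]
  have h2 : algebraMap F[X] (KInfty F) Polynomial.X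
      = algebraMap (RatFunc F) (KInfty F) (RatFunc.X) := by
    change algebraMap (RatFunc F) (KInfty F) (algebraMap F[X] (RatFunc F) Polynomial.X) = _
    rw [RatFunc.algebraMap_X]
  rw [h2]
  exact @Valued.extensionValuation_apply_coe (RatFunc F) _ ℤᵐ⁰ _ (RatFunc.inftyValued F) _

variable [Fintype F]

theorem one_lt_card : (1 : ℝ≥0) < (Fintype.card F : ℝ≥0) := by
  exact_mod_cast Fintype.one_lt_card (α := F)

/-- The value `exp n` of the valuation at infinity corresponds to the absolute value `q ^ n`. -/
instance : Valuation.RankOne (Valued.v : Valuation (KInfty F) ℤᵐ⁰) where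
  hom' := (WithZeroMulInt.toNNReal (ne_of_gt (lt_trans zero_lt_one (one_lt_card F)))).comp
    MonoidWithZeroHom.ValueGroup₀.embedding
  strictMono' := (WithZeroMulInt.toNNReal_strictMono (one_lt_card F)).comp
    MonoidWithZeroHom.ValueGroup₀.embedding_strictMono
  exists_val_nontrivial := ⟨T F, by simp [v_T]⟩

instance : NormedField (KInfty F) := Valued.toNormedField (KInfty F) ℤᵐ⁰

instance : IsUltrametricDist (KInfty F) :=
  inferInstanceAs (@IsUltrametricDist (KInfty F)
    (Valued.toNormedField (KInfty F) ℤᵐ⁰).toMetricSpace.toPseudoMetricSpace.toDist)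

/-- The normalization `|T| = q`. -/
theorem norm_T : ‖T F‖ = Fintype.card F := by
  change ((WithZeroMulInt.toNNReal (ne_of_gt (lt_trans zero_lt_one (one_lt_card F)))
    (MonoidWithZeroHom.ValueGroup₀.embedding (Valued.v.restrict (T F))) : ℝ≥0) : ℝ) = _
  rw [Valuation.embedding_restrict, v_T, WithZeroMulInt.toNNReal_neg_apply _ (by simp)]
  simp [WithZero.exp]

instance : NontriviallyNormedField (KInfty F) where
  non_trivial := ⟨T F, by rw [norm_T]; exact_mod_cast Fintype.one_lt_card (α := F)⟩

end KInfty

/-! ### The field `C`, the completed algebraic closure of `K_∞` -/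

section CInfty

variable (F : Type*) [Field F] [Fintype F]

/-- The algebraic closure of `K_∞` with the unique extension of the absolute value. -/
instance : NormedField (AlgebraicClosure (KInfty F)) :=
  spectralNorm.normedField (KInfty F) (AlgebraicClosure (KInfty F))

instance : NormedAlgebra (KInfty F) (AlgebraicClosure (KInfty F)) :=
  spectralNorm.normedAlgebra _ _

instance : UniformContinuousConstSMul (KInfty F) (AlgebraicClosure (KInfty F)) :=
  uniformContinuousConstSMul_of_continuousConstSMul _ _

/-- `C`: the completed algebraic closure of `K_∞`. -/
def CInfty : Type _ := UniformSpace.Completion (AlgebraicClosure (KInfty F))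

instance : NormedField (CInfty F) :=
  inferInstanceAs (NormedField (UniformSpace.Completion (AlgebraicClosure (KInfty F))))

instance : NormedAlgebra (KInfty F) (CInfty F) :=
  inferInstanceAs (NormedAlgebra (KInfty F)
    (UniformSpace.Completion (AlgebraicClosure (KInfty F))))

instance : CompleteSpace (CInfty F) :=
  inferInstanceAs (CompleteSpace (UniformSpace.Completion (AlgebraicClosure (KInfty F))))

instance : IsUltrametricDist (CInfty F) := IsUltrametricDist.of_normedAlgebra (KInfty F)

instance : Algebra F[X] (CInfty F) :=
  ((algebraMap (KInfty F) (CInfty F)).comp (algebraMap F[X] (KInfty F))).toAlgebra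

instance : IsScalarTower F[X] (KInfty F) (CInfty F) :=
  IsScalarTower.of_algebraMap_eq (congrFun rfl)

end CInfty

/-! ### Residue class degrees of subfields of `C` -/

section Residue

variable (F : Type*) [Field F] [Fintype F]

/-- The valuation ring `{x | |x| ≤ 1}` of a field `E` embedded in `C`. -/
def valuationRing (E : Type*) [Field E] [Algebra E (CInfty F)] : ValuationSubring E :=
  (NormedField.valuation (K := CInfty F)).valuationSubring.comap (algebraMap E (CInfty F))

theorem mem_valuationRing {E : Type*} [Field E] [Algebra E (CInfty F)] (x : E) :
    x ∈ valuationRing F E ↔ ‖algebraMap E (CInfty F) x‖ ≤ 1 := by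
  rfl

/-- For `E ⊆ E' ⊆ C`, the inclusion of the valuation rings. -/
@[reducible]
def valuationRingAlgebra (E E' : Type*) [Field E] [Field E'] [Algebra E E']
    [Algebra E (CInfty F)] [Algebra E' (CInfty F)] [IsScalarTower E E' (CInfty F)] :
    Algebra (valuationRing F E) (valuationRing F E') :=
  ((algebraMap E E').restrict (valuationRing F E) (valuationRing F E') (fun x hx => by
    rw [mem_valuationRing] at hx ⊢
    rwa [← IsScalarTower.algebraMap_apply])).toAlgebra

/-- The residue class degree `f(E'|E)`, for `E ⊆ E' ⊆ C`. -/
def residueDegree (E E' : Type*) [Field E] [Field E'] [Algebra E E']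
    [Algebra E (CInfty F)] [Algebra E' (CInfty F)] [IsScalarTower E E' (CInfty F)] : ℕ :=
  letI := valuationRingAlgebra F E E'
  (IsLocalRing.maximalIdeal (valuationRing F E')).inertiaDeg (valuationRing F E)

end Residue

/-! ### Lattices, Drinfeld modules, successive minimum bases -/

section Drinfeld

variable {F : Type*} [Field F] [Fintype F]

/-- An `A`-lattice of rank `r` in `C`: a discrete free `A`-submodule of rank `r`. -/
structure IsLattice (r : ℕ) (Λ : Submodule F[X] (CInfty F)) : Prop where
  discrete : DiscreteTopology Λ
  free : Module.Free F[X] Λ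
  finite : Module.Finite F[X] Λ
  rank_eq : Module.finrank F[X] Λ = r

/-- The exponential function `e_Λ(z) = z ∏_{0 ≠ λ ∈ Λ} (1 - z / λ)`. -/
def latticeExp (Λ : Submodule F[X] (CInfty F)) (z : CInfty F) : CInfty F :=
  z * ∏' l : {l : CInfty F // l ∈ Λ ∧ l ≠ 0}, (1 - z / (l : CInfty F))

/-- A Drinfeld `A`-module of rank `r` over `L`, given by the coefficients of its `T`-operator
polynomial; `coeff i` is the coefficient `g_{i+1}` of `X ^ (q ^ (i + 1))`. -/
structure DrinfeldModule (L : IntermediateField (KInfty F) (CInfty F)) (r : ℕ) where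
  coeff : Fin r → L
  leading_ne_zero : ∀ i : Fin r, (i : ℕ) + 1 = r → coeff i ≠ 0

/-- The `T`-operator polynomial `φ_T(X) = T X + g_1 X^q + ⋯ + g_r X^(q^r)`. -/
def DrinfeldModule.operatorT {L : IntermediateField (KInfty F) (CInfty F)} {r : ℕ}
    (φ : DrinfeldModule L r) : Polynomial L :=
  Polynomial.C (algebraMap (KInfty F) L (T F)) * Polynomial.X +
    ∑ i : Fin r, Polynomial.C (φ.coeff i) * Polynomial.X ^ (Fintype.card F ^ ((i : ℕ) + 1))

/-- `Λ` is the period lattice of the rank-`r` Drinfeld module `φ`. -/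
structure IsPeriodLattice {L : IntermediateField (KInfty F) (CInfty F)} {r : ℕ}
    (φ : DrinfeldModule L r) (Λ : Submodule F[X] (CInfty F)) : Prop where
  isLattice : IsLattice r Λ
  exp_T_mul : ∀ z : CInfty F,
    latticeExp Λ (algebraMap (KInfty F) (CInfty F) (T F) * z) =
      Polynomial.aeval (latticeExp Λ z) φ.operatorT

/-- `lam` is a successive minimum basis of `Λ`: each `lam i` has minimal absolute value among the
elements of `Λ` outside the `A`-span of the preceding ones. -/
structure IsSuccessiveMinimumBasis {r : ℕ} (Λ : Submodule F[X] (CInfty F))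
    (lam : Fin r → CInfty F) : Prop where
  mem : ∀ i, lam i ∈ Λ
  notMem_span : ∀ i, lam i ∉ Submodule.span F[X] (lam '' {j | j < i})
  norm_le : ∀ i, ∀ μ ∈ Λ, μ ∉ Submodule.span F[X] (lam '' {j | j < i}) → ‖lam i‖ ≤ ‖μ‖

/-- `B 0, …, B (t - 1)` are the (index sets of the) packets of vectors of equal length of the
family `lam`, ordered according to that length. -/
structure IsPacketSplitting {r : ℕ} (lam : Fin r → CInfty F) {t : ℕ}
    (B : Fin t → Finset (Fin r)) : Prop where
  nonempty : ∀ τ, (B τ).Nonempty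
  exists_mem : ∀ i, ∃ τ, i ∈ B τ
  norm_eq : ∀ τ, ∀ i ∈ B τ, ∀ j ∈ B τ, ‖lam i‖ = ‖lam j‖
  norm_lt : ∀ τ τ', τ < τ' → ∀ i ∈ B τ, ∀ j ∈ B τ', ‖lam i‖ < ‖lam j‖

/-- The field `L(Λ)` generated over `L` by the period lattice. -/
abbrev periodField (L : IntermediateField (KInfty F) (CInfty F))
    (Λ : Submodule F[X] (CInfty F)) : IntermediateField L (CInfty F) :=
  IntermediateField.adjoin L (Λ : Set (CInfty F))

end Drinfeld

end DrinfeldPeriods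

end

/-!
The field `L(Λ)` is a finite Galois extension of `L`: by successive approximation, the periods are
recovered from torsion points of `φ`, which are roots of separable polynomials. The Galois group
acts faithfully on `Λ` by `A`-linear isometries. In a successive minimum basis an isometry is block
triangular along the packets, and its diagonal blocks have entries in `𝔽`. An element of
`GL_n(𝔽)` has order at most `q ^ n - 1`, and a unipotent block triangular matrix with `t` blocks
in characteristic `p` has order dividing `p ^ (t - 1)`, so every element of the Galois group has
order at most `∏ (q ^ r_τ - 1) * p ^ (t - 1)`. On the other hand, the order of a lift of the
Frobenius automorphism of the residue field is a multiple of the residue class degree.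
-/

noncomputable section

open Filter Topology

namespace DrinfeldPeriods

/-! ### Absolute values of polynomials -/

theorem norm_sub_le_max {M : Type*} [SeminormedAddCommGroup M] [IsUltrametricDist M] (x y : M) :
    ‖x - y‖ ≤ max ‖x‖ ‖y‖ := by
  simpa [sub_eq_add_neg] using IsUltrametricDist.norm_add_le_max x (-y)

theorem norm_sum_lt_of_forall_lt {M ι : Type*} [SeminormedAddCommGroup M] [IsUltrametricDist M]
    {s : Finset ι} {f : ι → M} {c : ℝ} (hc : 0 < c) (h : ∀ i ∈ s, ‖f i‖ < c) :
    ‖∑ i ∈ s, f i‖ < c := by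
  rcases s.eq_empty_or_nonempty with rfl | hs
  · simpa using hc
  · obtain ⟨i, hi, hle⟩ := IsUltrametricDist.exists_norm_finsetSum_le_of_nonempty hs f
    exact hle.trans_lt (h i hi)

section PolynomialNorm

variable {F : Type*} [Field F] [Finite F] {E : Type*} [NormedField E]

theorem norm_map_C (ψ : F[X] →+* E) {c : F} (hc : c ≠ 0) : ‖ψ (Polynomial.C c)‖ = 1 :=
  ((ψ.comp Polynomial.C).toMonoidHom.isOfFinOrder
    ((Units.coeHom F).isOfFinOrder (isOfFinOrder_of_finite (Units.mk0 c hc)))).norm_eq_one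

theorem norm_map_C_le_one (ψ : F[X] →+* E) (c : F) : ‖ψ (Polynomial.C c)‖ ≤ 1 := by
  rcases eq_or_ne c 0 with rfl | hc
  · simp
  · exact (norm_map_C ψ hc).le

variable [IsUltrametricDist E] {ψ : F[X] →+* E}

theorem norm_map_eq_pow_natDegree (hX : 1 < ‖ψ Polynomial.X‖) {a : F[X]} (ha : a ≠ 0) :
    ‖ψ a‖ = ‖ψ Polynomial.X‖ ^ a.natDegree := by
  let _ : Algebra F E := (ψ.comp Polynomial.C).toAlgebra
  have : (NormedField.valuation (K := E)).IsTrivialOn F :=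
    ⟨fun c hc => NNReal.eq (norm_map_C ψ hc)⟩
  have haeval : Polynomial.aeval (ψ Polynomial.X) a = ψ a :=
    (Polynomial.hom_eval₂ a Polynomial.C ψ Polynomial.X).symm.trans
      (congrArg ψ Polynomial.eval₂_C_X)
  rw [← haeval]
  exact congrArg NNReal.toReal
    (Polynomial.valuation_aeval_eq_valuation_X_pow_natDegree_of_one_lt_valuation_X
      (v := NormedField.valuation) (ψ Polynomial.X) hX ha)

theorem norm_map_lt_norm_map (hX : 1 < ‖ψ Polynomial.X‖) {a b : F[X]} (hab : a.degree < b.degree) :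
    ‖ψ a‖ < ‖ψ b‖ := by
  have hb : b ≠ 0 := Polynomial.ne_zero_of_degree_gt hab
  rw [norm_map_eq_pow_natDegree hX hb]
  rcases eq_or_ne a 0 with rfl | ha
  · simpa using pow_pos (one_pos.trans hX) _
  · rw [norm_map_eq_pow_natDegree hX ha]
    exact pow_lt_pow_right₀ hX (Polynomial.natDegree_lt_natDegree ha hab)

end PolynomialNorm

section AbsoluteValue

variable {F : Type*} [Field F] [Fintype F]

theorem one_lt_norm_X_KInfty : 1 < ‖algebraMap F[X] (KInfty F) Polynomial.X‖ := by
  change 1 < ‖T F‖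
  rw [norm_T]
  exact_mod_cast Fintype.one_lt_card (α := F)

theorem one_lt_norm_X : 1 < ‖algebraMap F[X] (CInfty F) Polynomial.X‖ := by
  rw [IsScalarTower.algebraMap_apply F[X] (KInfty F) (CInfty F), norm_algebraMap']
  exact one_lt_norm_X_KInfty

theorem norm_polynomial_smul (a : F[X]) (z : CInfty F) :
    ‖a • z‖ = ‖algebraMap F[X] (CInfty F) a‖ * ‖z‖ := by
  rw [Algebra.smul_def, norm_mul]

theorem norm_algebraMap_pos {a : F[X]} (ha : a ≠ 0) : 0 < ‖algebraMap F[X] (CInfty F) a‖ := by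
  rw [norm_map_eq_pow_natDegree one_lt_norm_X ha]
  exact pow_pos (one_pos.trans one_lt_norm_X) _

theorem norm_le_norm_smul {a : F[X]} (ha : a ≠ 0) (z : CInfty F) : ‖z‖ ≤ ‖a • z‖ := by
  rw [norm_polynomial_smul, norm_map_eq_pow_natDegree one_lt_norm_X ha]
  exact le_mul_of_one_le_left (norm_nonneg z) (one_le_pow₀ one_lt_norm_X.le)

theorem norm_smul_pos {a : F[X]} (ha : a ≠ 0) {z : CInfty F} (hz : z ≠ 0) : 0 < ‖a • z‖ :=
  (norm_pos_iff.2 hz).trans_le (norm_le_norm_smul ha z)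

theorem norm_smul_le_norm_smul_left {a : F[X]} (ha : a ≠ 0) {z w : CInfty F} :
    ‖a • z‖ ≤ ‖a • w‖ ↔ ‖z‖ ≤ ‖w‖ := by
  rw [norm_polynomial_smul, norm_polynomial_smul, mul_le_mul_iff_right₀ (norm_algebraMap_pos ha)]

theorem norm_smul_lt_norm_smul {a b : F[X]} (hab : a.degree < b.degree) {z w : CInfty F}
    (hzw : ‖z‖ ≤ ‖w‖) (hw : w ≠ 0) : ‖a • z‖ < ‖b • w‖ := by
  rw [norm_polynomial_smul, norm_polynomial_smul]
  exact mul_lt_mul_of_lt_of_le_of_nonneg_of_pos (norm_map_lt_norm_map one_lt_norm_X hab) hzw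
    (norm_nonneg _) (norm_pos_iff.2 hw)

end AbsoluteValue

/-! ### Successive minimum bases -/

theorem exists_smul_mem_span_of_card_eq_finrank {R M ι : Type*} [CommRing R] [IsDomain R]
    [AddCommGroup M] [Module R M] [Module.Finite R M] [Fintype ι] {v : ι → M}
    (hv : LinearIndependent R v) (hcard : Fintype.card ι = Module.finrank R M) (x : M) :
    ∃ a : R, a ≠ 0 ∧ a • x ∈ Submodule.span R (Set.range v) := by
  have hquot := Submodule.finrank_quotient_add_finrank (Submodule.span R (Set.range v))
  rw [finrank_span_eq_card hv, hcard, Nat.add_eq_right, Module.finrank_eq_zero_iff] at hquot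
  obtain ⟨a, ha, hax⟩ := hquot (Submodule.Quotient.mk x)
  exact ⟨a, ha, (Submodule.Quotient.mk_eq_zero _).1 hax⟩

theorem smul_sum_div_add_sum_mod {F : Type*} [Field F] {M ι : Type*} [AddCommGroup M]
    [Module F[X] M] (s : Finset ι) (a : F[X]) (b : ι → F[X]) (v : ι → M) :
    a • ∑ i ∈ s, (b i / a) • v i + ∑ i ∈ s, (b i % a) • v i = ∑ i ∈ s, b i • v i := by
  simp only [Finset.smul_sum, smul_smul, ← Finset.sum_add_distrib, ← add_smul,
    EuclideanDomain.div_add_mod]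

section SuccessiveMinima

variable {F : Type*} [Field F] [Fintype F]

theorem norm_sum_mod_smul_lt {ι : Type*} {s : Finset ι} {v : ι → CInfty F} {a : F[X]}
    (ha : a ≠ 0) (b : ι → F[X]) {z : CInfty F} (hz : z ≠ 0) (hv : ∀ i ∈ s, ‖v i‖ ≤ ‖z‖) :
    ‖∑ i ∈ s, (b i % a) • v i‖ < ‖a • z‖ :=
  norm_sum_lt_of_forall_lt (norm_smul_pos ha hz) fun i hi =>
    norm_smul_lt_norm_smul (EuclideanDomain.mod_lt (b i) ha) (hv i hi) hz

theorem finite_setOf_norm_smul_le {z : CInfty F} (hz : z ≠ 0) (R : ℝ) :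
    {a : F[X] | ‖a • z‖ ≤ R}.Finite := by
  have hz' := norm_pos_iff.2 hz
  obtain ⟨n, hn⟩ := pow_unbounded_of_one_lt (R / ‖z‖) (one_lt_norm_X (F := F))
  have : Finite (Polynomial.degreeLT F n) :=
    Finite.of_equiv _ (Polynomial.degreeLTEquiv F n).symm.toEquiv
  refine (Set.toFinite (Polynomial.degreeLT F n : Set F[X])).subset fun a ha => ?_
  rcases eq_or_ne a 0 with rfl | ha0
  · exact Submodule.zero_mem _
  rw [Set.mem_ofPred_eq, norm_polynomial_smul, ← le_div_iff₀ hz',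
    norm_map_eq_pow_natDegree one_lt_norm_X ha0] at ha
  exact Polynomial.mem_degreeLT.2 <| (Polynomial.natDegree_lt_iff_degree_lt ha0).1 <|
    (pow_lt_pow_iff_right₀ one_lt_norm_X).1 (ha.trans_lt hn)

namespace IsSuccessiveMinimumBasis

variable {r : ℕ} {Λ : Submodule F[X] (CInfty F)} {lam : Fin r → CInfty F}

theorem ne_zero (h : IsSuccessiveMinimumBasis Λ lam) (i : Fin r) : lam i ≠ 0 := fun h0 =>
  h.notMem_span i (h0 ▸ Submodule.zero_mem _)

theorem norm_mono (h : IsSuccessiveMinimumBasis Λ lam) {i j : Fin r} (hij : i ≤ j) :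
    ‖lam i‖ ≤ ‖lam j‖ :=
  h.norm_le i _ (h.mem j) fun hmem => h.notMem_span j <|
    Submodule.span_mono (Set.image_mono fun _ hk => lt_of_lt_of_le hk hij) hmem

theorem sum_smul_mem (h : IsSuccessiveMinimumBasis Λ lam) (s : Finset (Fin r))
    (a : Fin r → F[X]) : ∑ j ∈ s, a j • lam j ∈ Λ :=
  Submodule.sum_mem _ fun j _ => Submodule.smul_mem _ _ (h.mem j)

theorem norm_smul_le_norm_smul_add_sum (h : IsSuccessiveMinimumBasis Λ lam) (a : Fin r → F[X])
    {s : Finset (Fin r)} {k : Fin r} (hs : ∀ j ∈ s, j < k) :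
    ‖a k • lam k‖ ≤ ‖a k • lam k + ∑ j ∈ s, a j • lam j‖ := by
  rcases eq_or_ne (a k) 0 with hk | hk
  · simp [hk]
  set y := ∑ j ∈ s, (a j / a k) • lam j
  set z := ∑ j ∈ s, (a j % a k) • lam j
  have hz : ‖z‖ < ‖a k • lam k‖ :=
    norm_sum_mod_smul_lt hk a (h.ne_zero k) fun j hj => h.norm_mono (hs j hj).le
  have hy : y ∈ Submodule.span F[X] (lam '' {j | j < k}) :=
    Submodule.sum_mem _ fun j hj =>
      Submodule.smul_mem _ _ (Submodule.subset_span ⟨j, hs j hj, rfl⟩)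
  have hle : ‖a k • lam k‖ ≤ ‖a k • (lam k + y)‖ :=
    (norm_smul_le_norm_smul_left hk).2 <|
      h.norm_le k _ (Λ.add_mem (h.mem k) (h.sum_smul_mem s _)) fun hmem =>
        h.notMem_span k ((Submodule.add_mem_iff_left _ hy).1 hmem)
  rw [← smul_sum_div_add_sum_mod s (a k) a lam, ← add_assoc, ← smul_add,
    IsUltrametricDist.norm_add_eq_max_of_norm_ne_norm (hz.trans_le hle).ne']
  exact hle.trans (le_max_left _ _)

theorem norm_smul_le_norm_sum (h : IsSuccessiveMinimumBasis Λ lam) (a : Fin r → F[X])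
    {s : Finset (Fin r)} {i : Fin r} (hi : i ∈ s) :
    ‖a i • lam i‖ ≤ ‖∑ j ∈ s, a j • lam j‖ := by
  induction s using Finset.induction_on_max generalizing i with
  | empty => simp at hi
  | insert k s hs ih =>
    have hk := h.norm_smul_le_norm_smul_add_sum a hs
    rw [Finset.sum_insert fun hks => (hs k hks).false]
    rcases Finset.mem_insert.1 hi with rfl | hi
    · exact hk
    · calc ‖a i • lam i‖ ≤ ‖∑ j ∈ s, a j • lam j‖ := ih hi
        _ = ‖a k • lam k + ∑ j ∈ s, a j • lam j - a k • lam k‖ := by rw [add_sub_cancel_left]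
        _ ≤ max ‖a k • lam k + ∑ j ∈ s, a j • lam j‖ ‖a k • lam k‖ :=
          norm_sub_le_max _ _
        _ = ‖a k • lam k + ∑ j ∈ s, a j • lam j‖ := max_eq_left hk

theorem linearIndependent (h : IsSuccessiveMinimumBasis Λ lam) : LinearIndependent F[X] lam := by
  refine Fintype.linearIndependent_iff.2 fun a ha i => by_contra fun hai => ?_
  have := h.norm_smul_le_norm_sum a (Finset.mem_univ i)
  rw [ha, norm_zero] at this
  exact this.not_gt (norm_smul_pos hai (h.ne_zero i))

theorem exists_smul_mem_span (h : IsSuccessiveMinimumBasis Λ lam) (hΛ : IsLattice r Λ)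
    {μ : CInfty F} (hμ : μ ∈ Λ) :
    ∃ a : F[X], a ≠ 0 ∧ a • μ ∈ Submodule.span F[X] (Set.range lam) := by
  have := hΛ.finite
  let v : Fin r → Λ := fun i => ⟨lam i, h.mem i⟩
  have hv : LinearIndependent F[X] v := .of_comp Λ.subtype h.linearIndependent
  obtain ⟨a, ha, hmem⟩ := exists_smul_mem_span_of_card_eq_finrank hv
    ((Fintype.card_fin r).trans hΛ.rank_eq.symm) ⟨μ, hμ⟩
  refine ⟨a, ha, ?_⟩
  have := Submodule.mem_map_of_mem (f := Λ.subtype) hmem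
  rwa [Submodule.map_span, ← Set.range_comp] at this

theorem span_eq (h : IsSuccessiveMinimumBasis Λ lam) (hΛ : IsLattice r Λ) :
    Submodule.span F[X] (Set.range lam) = Λ := by
  refine le_antisymm (Submodule.span_le.2 (Set.range_subset_iff.2 h.mem)) fun μ hμ => ?_
  obtain ⟨a, ha, hspan⟩ := h.exists_smul_mem_span hΛ hμ
  obtain ⟨b, hb⟩ := (Submodule.mem_span_range_iff_exists_fun F[X]).1 hspan
  set y := ∑ i, (b i / a) • lam i
  have hy : y ∈ Submodule.span F[X] (Set.range lam) :=
    (Submodule.mem_span_range_iff_exists_fun F[X]).2 ⟨_, rfl⟩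
  by_contra hμspan
  have hν : μ - y ∉ Submodule.span F[X] (Set.range lam) := fun hmem =>
    hμspan ((Submodule.sub_mem_iff_left _ hy).1 hmem)
  have haν : a • (μ - y) = ∑ i, (b i % a) • lam i := by
    rw [smul_sub, ← hb, ← smul_sum_div_add_sum_mod, add_sub_cancel_left]
  refine (norm_sum_mod_smul_lt ha b (z := μ - y) (s := Finset.univ) (v := lam) ?_ ?_).ne
    (congrArg norm haν.symm)
  · rintro h0
    exact hν (h0 ▸ Submodule.zero_mem _)
  · exact fun i _ => h.norm_le i _ (Λ.sub_mem hμ (h.sum_smul_mem _ _)) fun hmem =>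
      hν (Submodule.span_mono (Set.image_subset_range _ _) hmem)

theorem exists_eq_sum (h : IsSuccessiveMinimumBasis Λ lam) (hΛ : IsLattice r Λ)
    {μ : CInfty F} (hμ : μ ∈ Λ) : ∃ a : Fin r → F[X], ∑ i, a i • lam i = μ :=
  (Submodule.mem_span_range_iff_exists_fun F[X]).1 ((h.span_eq hΛ).ge hμ)

theorem finite_norm_le (h : IsSuccessiveMinimumBasis Λ lam) (hΛ : IsLattice r Λ) (R : ℝ) :
    {l | l ∈ Λ ∧ ‖l‖ ≤ R}.Finite := by
  refine ((Set.Finite.pi' fun i => finite_setOf_norm_smul_le (h.ne_zero i) R).image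
    fun a => ∑ i, a i • lam i).subset ?_
  rintro l ⟨hl, hlR⟩
  obtain ⟨a, rfl⟩ := h.exists_eq_sum hΛ hl
  exact ⟨a, fun i => (h.norm_smul_le_norm_sum a (Finset.mem_univ i)).trans hlR, rfl⟩

theorem norm_zero_le [NeZero r] (h : IsSuccessiveMinimumBasis Λ lam) {l : CInfty F} (hl : l ∈ Λ)
    (hl0 : l ≠ 0) : ‖lam 0‖ ≤ ‖l‖ :=
  h.norm_le 0 l hl (by simpa using hl0)

end IsSuccessiveMinimumBasis

end SuccessiveMinima

/-! ### The lattice exponential -/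

theorem exists_finset_forall_notMem_norm_sub_le {M ι : Type*} [SeminormedAddCommGroup M]
    {f : ι → M} {x : M} (hf : Tendsto f cofinite (𝓝 x)) {δ : ℝ} (hδ : 0 < δ) :
    ∃ s : Finset ι, ∀ i ∉ s, ‖f i - x‖ ≤ δ := by
  have hfin : {i | ¬ ‖f i - x‖ < δ}.Finite := by
    simpa only [dist_eq_norm] using eventually_cofinite.1 (Metric.tendsto_nhds.1 hf δ hδ)
  exact ⟨hfin.toFinset, fun i hi => by simpa using le_of_lt (by simpa using hi)⟩

section InfiniteProduct

variable {E ι : Type*} [NormedField E] [IsUltrametricDist E] {f : ι → E}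

theorem norm_prod_sub_one_le {s : Finset ι} {δ : ℝ} (h0 : 0 ≤ δ) (h1 : δ ≤ 1)
    (h : ∀ i ∈ s, ‖f i - 1‖ ≤ δ) : ‖∏ i ∈ s, f i - 1‖ ≤ δ := by
  classical
  induction s using Finset.induction_on with
  | empty => simpa using h0
  | insert a s ha ih =>
    set P := ∏ i ∈ s, f i
    have hP : ‖P - 1‖ ≤ δ := ih fun i hi => h i (Finset.mem_insert_of_mem hi)
    have hfa : ‖f a‖ ≤ 1 := by
      rw [← sub_add_cancel (f a) 1]
      exact (IsUltrametricDist.norm_add_le_max _ _).trans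
        (max_le ((h a (Finset.mem_insert_self a s)).trans h1) norm_one.le)
    rw [Finset.prod_insert ha, show f a * P - 1 = f a * (P - 1) + (f a - 1) by ring]
    refine (IsUltrametricDist.norm_add_le_max _ _).trans
      (max_le ?_ (h a (Finset.mem_insert_self a s)))
    rw [norm_mul]
    exact (mul_le_of_le_one_left (norm_nonneg _) hfa).trans hP

theorem norm_prod_sub_prod_le {s t : Finset ι} (hst : s ⊆ t) {δ : ℝ} (h0 : 0 ≤ δ)
    (h1 : δ ≤ 1) (h : ∀ i ∉ s, ‖f i - 1‖ ≤ δ) :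
    ‖∏ i ∈ t, f i - ∏ i ∈ s, f i‖ ≤ δ * ‖∏ i ∈ s, f i‖ := by
  classical
  rw [← Finset.prod_sdiff hst, ← sub_one_mul, norm_mul]
  gcongr
  exact norm_prod_sub_one_le h0 h1 fun i hi => h i (Finset.mem_sdiff.1 hi).2

theorem norm_tprod_sub_prod_le {s : Finset ι} (hf : Multipliable f) {δ : ℝ}
    (h0 : 0 ≤ δ) (h1 : δ ≤ 1) (h : ∀ i ∉ s, ‖f i - 1‖ ≤ δ) :
    ‖∏' i, f i - ∏ i ∈ s, f i‖ ≤ δ * ‖∏ i ∈ s, f i‖ :=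
  le_of_tendsto (hf.hasProd.sub_const _).norm
    ((eventually_ge_atTop s).mono fun _ hst => norm_prod_sub_prod_le hst h0 h1 h)

theorem multipliable_of_tendsto_cofinite [CompleteSpace E] (hf : Tendsto f cofinite (𝓝 1)) :
    Multipliable f := by
  classical
  suffices CauchySeq fun s : Finset ι => ∏ i ∈ s, f i from
    let ⟨x, hx⟩ := cauchySeq_tendsto_of_complete this
    ⟨x, hx⟩
  refine Metric.cauchySeq_iff'.2 fun ε hε => ?_
  obtain ⟨s₁, hs₁⟩ := exists_finset_forall_notMem_norm_sub_le hf one_pos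
  obtain ⟨δ, hδ, hδε⟩ := exists_pos_mul_lt hε ‖∏ i ∈ s₁, f i‖
  obtain ⟨s, hs⟩ := exists_finset_forall_notMem_norm_sub_le hf (lt_min hδ one_pos)
  have hle : ‖∏ i ∈ s₁ ∪ s, f i‖ ≤ ‖∏ i ∈ s₁, f i‖ := by
    have hsub := norm_prod_sub_prod_le (s₁.subset_union_left (s₂ := s)) zero_le_one le_rfl hs₁
    rw [one_mul] at hsub
    rw [← sub_add_cancel (∏ i ∈ s₁ ∪ s, f i) (∏ i ∈ s₁, f i)]
    exact (IsUltrametricDist.norm_add_le_max _ _).trans (max_le hsub le_rfl)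
  refine ⟨s₁ ∪ s, fun t ht => ?_⟩
  calc dist (∏ i ∈ t, f i) (∏ i ∈ s₁ ∪ s, f i)
      ≤ min δ 1 * ‖∏ i ∈ s₁ ∪ s, f i‖ := by
        rw [dist_eq_norm]
        exact norm_prod_sub_prod_le ht (by positivity) (min_le_right _ _)
          fun i hi => hs i fun his => hi (Finset.mem_union_right _ his)
    _ ≤ δ * ‖∏ i ∈ s₁, f i‖ := by gcongr; exact min_le_left _ _
    _ < ε := by rwa [mul_comm]

theorem exists_eq_zero_of_tprod_eq_zero [CompleteSpace E] (hf : Tendsto f cofinite (𝓝 1))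
    (h0 : ∏' i, f i = 0) : ∃ i, f i = 0 := by
  obtain ⟨s, hs⟩ := exists_finset_forall_notMem_norm_sub_le hf one_half_pos
  have hle := norm_tprod_sub_prod_le (multipliable_of_tendsto_cofinite hf) one_half_pos.le
    one_half_lt_one.le hs
  rw [h0, zero_sub, norm_neg] at hle
  have hprod : ∏ i ∈ s, f i = 0 := by
    rw [← norm_eq_zero]
    linarith [norm_nonneg (∏ i ∈ s, f i)]
  obtain ⟨i, -, hi⟩ := Finset.prod_eq_zero_iff.1 hprod
  exact ⟨i, hi⟩

end InfiniteProduct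

section LatticeExp

variable {F : Type*} [Field F] [Fintype F] {r : ℕ} {Λ : Submodule F[X] (CInfty F)}
  {lam : Fin r → CInfty F}

theorem latticeExp_of_mem {z : CInfty F} (hz : z ∈ Λ) : latticeExp Λ z = 0 := by
  rcases eq_or_ne z 0 with rfl | hz0
  · exact zero_mul _
  · rw [latticeExp, tprod_of_exists_eq_zero ⟨⟨z, hz, hz0⟩, by simp [hz0]⟩, mul_zero]

namespace IsSuccessiveMinimumBasis

theorem tendsto_one_sub_div (h : IsSuccessiveMinimumBasis Λ lam) (hΛ : IsLattice r Λ)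
    (z : CInfty F) :
    Tendsto (fun l : {l : CInfty F // l ∈ Λ ∧ l ≠ 0} => 1 - z / (l : CInfty F)) cofinite
      (𝓝 1) := by
  refine Metric.tendsto_nhds.2 fun δ hδ => eventually_cofinite.2 <|
    ((h.finite_norm_le hΛ (‖z‖ / δ)).preimage Subtype.val_injective.injOn).subset
      fun l hl => ⟨l.2.1, ?_⟩
  rw [Set.mem_ofPred_eq, dist_eq_norm, sub_sub_cancel_left, norm_neg, norm_div, not_lt,
    le_div_iff₀ (norm_pos_iff.2 l.2.2)] at hl
  rwa [le_div_iff₀ hδ, mul_comm]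

theorem mem_of_latticeExp_eq_zero (h : IsSuccessiveMinimumBasis Λ lam) (hΛ : IsLattice r Λ)
    {z : CInfty F} (hz : latticeExp Λ z = 0) : z ∈ Λ := by
  rcases mul_eq_zero.1 hz with rfl | h0
  · exact Λ.zero_mem
  · obtain ⟨l, hl⟩ := exists_eq_zero_of_tprod_eq_zero (h.tendsto_one_sub_div hΛ z) h0
    exact eq_of_div_eq_one (sub_eq_zero.1 hl).symm ▸ l.2.1

theorem norm_latticeExp_sub_le [NeZero r] (h : IsSuccessiveMinimumBasis Λ lam)
    (hΛ : IsLattice r Λ) {z : CInfty F} (hz : ‖z‖ ≤ ‖lam 0‖) :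
    ‖latticeExp Λ z - z‖ ≤ ‖z‖ / ‖lam 0‖ * ‖z‖ := by
  have hpos : 0 < ‖lam 0‖ := norm_pos_iff.2 (h.ne_zero 0)
  have hle := norm_tprod_sub_prod_le (s := ∅)
    (multipliable_of_tendsto_cofinite (h.tendsto_one_sub_div hΛ z)) (δ := ‖z‖ / ‖lam 0‖)
    (by positivity) ((div_le_one hpos).2 hz) fun l _ => by
      rw [sub_sub_cancel_left, norm_neg, norm_div]
      exact div_le_div_of_nonneg_left (norm_nonneg z) hpos (h.norm_zero_le l.2.1 l.2.2)
  rw [Finset.prod_empty, norm_one, mul_one] at hle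
  rw [latticeExp, ← mul_sub_one, norm_mul, mul_comm]
  gcongr

end IsSuccessiveMinimumBasis

end LatticeExp

/-! ### The functional equation of the exponential -/

section Analytic

variable {K R : Type*} [NontriviallyNormedField K] [IsUltrametricDist K] [CommRing R]
  [Algebra R K]

theorem exists_norm_aeval_le_of_derivative_eq_C {P : R[X]} {c : R}
    (hP : P.derivative = Polynomial.C c) (h0 : Polynomial.aeval (0 : K) P = 0)
    (hc : algebraMap R K c ≠ 0) :
    ∃ ρ > 0, ∀ z : K, ‖z‖ ≤ ρ → ‖Polynomial.aeval z P‖ ≤ ‖algebraMap R K c‖ * ‖z‖ := by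
  have hd := P.hasDerivAt_aeval (0 : K)
  rw [hP, Polynomial.aeval_C, hasDerivAt_iff_isLittleO_nhds_zero] at hd
  obtain ⟨ρ, hρ, hle⟩ :=
    Metric.nhds_basis_closedBall.eventually_iff.1 (hd.def (norm_pos_iff.2 hc))
  refine ⟨ρ, hρ, fun z hz => ?_⟩
  have hz' := hle (mem_closedBall_zero_iff.2 hz)
  rw [zero_add, h0, sub_zero, smul_eq_mul] at hz'
  rw [← sub_add_cancel (Polynomial.aeval z P) (z * algebraMap R K c)]
  exact (IsUltrametricDist.norm_add_le_max _ _).trans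
    (max_le hz' (by rw [norm_mul, mul_comm]))

end Analytic

theorem norm_algHom_eq_spectralNorm {K E Ω : Type*} [NontriviallyNormedField K]
    [IsUltrametricDist K] [CompleteSpace K] [Field E] [Algebra K E] [Algebra.IsAlgebraic K E]
    [NormedField Ω] [NormedAlgebra K Ω] (σ : E →ₐ[K] Ω) (x : E) :
    ‖σ x‖ = spectralNorm K E x :=
  spectralNorm_unique_field_norm_ext
    (f := (NormedField.toAbsoluteValue Ω).comp σ.toRingHom.injective)
    (fun y => (congrArg norm (σ.commutes y)).trans (norm_algebraMap' Ω y)) x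

namespace CInfty

variable (F : Type*) [Field F] [Fintype F]

instance : NontriviallyNormedField (CInfty F) where
  non_trivial := ⟨_, one_lt_norm_X⟩

/-- The element `T` of `C`. -/
def T : CInfty F := algebraMap (KInfty F) (CInfty F) (DrinfeldPeriods.T F)

theorem one_lt_norm_T : 1 < ‖T F‖ := one_lt_norm_X

theorem T_ne_zero : T F ≠ 0 := norm_pos_iff.1 (one_pos.trans (one_lt_norm_T F))

theorem tendsto_div_T_pow (z : CInfty F) : Tendsto (fun m : ℕ => z / T F ^ m) atTop (𝓝 0) := by
  have h := (tendsto_pow_atTop_nhds_zero_of_norm_lt_one (x := (T F)⁻¹) (by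
    rw [norm_inv]; exact inv_lt_one_of_one_lt₀ (one_lt_norm_T F))).const_mul z
  simpa only [div_eq_mul_inv, inv_pow, mul_zero] using h

end CInfty

namespace DrinfeldModule

variable {F : Type*} [Field F] [Fintype F] {L : IntermediateField (KInfty F) (CInfty F)} {r : ℕ}
  (φ : DrinfeldModule L r)

theorem aeval_operatorT_add (x y : CInfty F) :
    Polynomial.aeval (x + y) φ.operatorT =
      Polynomial.aeval x φ.operatorT + Polynomial.aeval y φ.operatorT := by
  let _ : Algebra F (CInfty F) := ((algebraMap F[X] (CInfty F)).comp Polynomial.C).toAlgebra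
  have hpow (n : ℕ) : (x + y) ^ Fintype.card F ^ n =
      x ^ Fintype.card F ^ n + y ^ Fintype.card F ^ n := by
    simpa only [AlgHom.coe_pow, FiniteField.coe_frobeniusAlgHom, pow_iterate] using
      map_add (FiniteField.frobeniusAlgHom F (CInfty F) ^ n) x y
  simp only [operatorT, map_add, map_mul, map_sum, map_pow, Polynomial.aeval_C,
    Polynomial.aeval_X, hpow, mul_add, Finset.sum_add_distrib]
  ring

theorem derivative_operatorT :
    φ.operatorT.derivative = Polynomial.C (algebraMap (KInfty F) L (T F)) := by
  have hcard : ((Fintype.card F : ℕ) : L[X]) = 0 := by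
    rw [← map_natCast (Polynomial.C.comp ((algebraMap (KInfty F) L).comp
      ((algebraMap F[X] (KInfty F)).comp Polynomial.C))), FiniteField.cast_card_eq_zero, map_zero]
  simp [operatorT, Polynomial.derivative_X_pow, hcard]

/-- The polynomial `φ_{T^m}`, the `m`-th iterate of `φ_T`. -/
def operatorTPow : ℕ → L[X]
  | 0 => Polynomial.X
  | m + 1 => φ.operatorT.comp (operatorTPow m)

theorem aeval_operatorTPow_succ {E : Type*} [Semiring E] [Algebra L E] (m : ℕ) (z : E) :
    Polynomial.aeval z (φ.operatorTPow (m + 1)) =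
      Polynomial.aeval (Polynomial.aeval z (φ.operatorTPow m)) φ.operatorT :=
  Polynomial.aeval_comp z

theorem aeval_operatorTPow_add (m : ℕ) (x y : CInfty F) :
    Polynomial.aeval (x + y) (φ.operatorTPow m) =
      Polynomial.aeval x (φ.operatorTPow m) + Polynomial.aeval y (φ.operatorTPow m) := by
  induction m with
  | zero => simp only [operatorTPow, Polynomial.aeval_X]
  | succ m ih => simp only [aeval_operatorTPow_succ, ih, aeval_operatorT_add]

theorem derivative_operatorTPow (m : ℕ) :
    (φ.operatorTPow m).derivative = Polynomial.C (algebraMap (KInfty F) L (T F) ^ m) := by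
  induction m with
  | zero => simp [operatorTPow]
  | succ m ih =>
    rw [operatorTPow, Polynomial.derivative_comp, derivative_operatorT, Polynomial.C_comp, ih,
      ← Polynomial.C_mul, pow_succ]

theorem separable_operatorTPow (m : ℕ) : (φ.operatorTPow m).Separable := by
  have hT : algebraMap (KInfty F) L (T F) ≠ 0 := fun h =>
    CInfty.T_ne_zero F (congrArg (algebraMap L (CInfty F)) h)
  rw [Polynomial.Separable, derivative_operatorTPow]
  exact isCoprime_one_right.of_isCoprime_of_dvd_right
    (Polynomial.isUnit_C.2 (IsUnit.mk0 _ (pow_ne_zero m hT))).dvd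

theorem exists_norm_aeval_operatorTPow_le :
    ∃ ρ > 0, ∀ (m : ℕ) (z : CInfty F), ‖CInfty.T F‖ ^ m * ‖z‖ ≤ ρ →
      ‖Polynomial.aeval z (φ.operatorTPow m)‖ ≤ ‖CInfty.T F‖ ^ m * ‖z‖ := by
  have h0 : Polynomial.aeval (0 : CInfty F) φ.operatorT = 0 := by
    simpa using φ.aeval_operatorT_add 0 0
  obtain ⟨ρ, hρ, hle⟩ := exists_norm_aeval_le_of_derivative_eq_C φ.derivative_operatorT h0
    (CInfty.T_ne_zero F)
  refine ⟨ρ, hρ, fun m => ?_⟩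
  induction m with
  | zero => simp [operatorTPow]
  | succ m ih =>
    intro z hz
    have hmono : ‖CInfty.T F‖ ^ m * ‖z‖ ≤ ‖CInfty.T F‖ ^ (m + 1) * ‖z‖ := by
      gcongr
      exacts [(CInfty.one_lt_norm_T F).le, m.le_succ]
    have hm := ih z (hmono.trans hz)
    rw [aeval_operatorTPow_succ, pow_succ', mul_assoc]
    exact (hle _ (hm.trans (hmono.trans hz))).trans (mul_le_mul_of_nonneg_left hm (norm_nonneg _))

end DrinfeldModule

namespace IsPeriodLattice

variable {F : Type*} [Field F] [Fintype F] {L : IntermediateField (KInfty F) (CInfty F)} {r : ℕ}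
  {φ : DrinfeldModule L r} {Λ : Submodule F[X] (CInfty F)} {lam : Fin r → CInfty F}

theorem latticeExp_T_pow_mul (hΛ : IsPeriodLattice φ Λ) (m : ℕ) (z : CInfty F) :
    latticeExp Λ (CInfty.T F ^ m * z) =
      Polynomial.aeval (latticeExp Λ z) (φ.operatorTPow m) := by
  induction m with
  | zero => simp [DrinfeldModule.operatorTPow]
  | succ m ih =>
    rw [pow_succ', mul_assoc, φ.aeval_operatorTPow_succ, ← ih]
    exact hΛ.exp_T_mul _

variable [NeZero r]

theorem tendsto_latticeExp (hΛ : IsPeriodLattice φ Λ) (h : IsSuccessiveMinimumBasis Λ lam)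
    (z : CInfty F) :
    Tendsto (fun m => Polynomial.aeval (z / CInfty.T F ^ m) (φ.operatorTPow m)) atTop
      (𝓝 (latticeExp Λ z)) := by
  set d : ℕ → CInfty F := fun m => latticeExp Λ (z / CInfty.T F ^ m) - z / CInfty.T F ^ m
  have hT : 0 < ‖CInfty.T F‖ := one_pos.trans (CInfty.one_lt_norm_T F)
  have hsmall : ∀ ε > 0, ∀ᶠ m : ℕ in atTop, ‖z / CInfty.T F ^ m‖ ≤ ε := fun ε hε =>
    (CInfty.tendsto_div_T_pow F z).norm.eventually_le_const (by simpa using hε)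
  have hd : Tendsto (fun m => ‖CInfty.T F‖ ^ m * ‖d m‖) atTop (𝓝 0) := by
    have hlim := (CInfty.tendsto_div_T_pow F z).norm.mul_const (‖z‖ / ‖lam 0‖)
    rw [norm_zero, zero_mul] at hlim
    refine squeeze_zero' (.of_forall fun m => by positivity) ?_ hlim
    filter_upwards [hsmall _ (norm_pos_iff.2 (h.ne_zero 0))] with m hm
    calc ‖CInfty.T F‖ ^ m * ‖d m‖
        ≤ ‖CInfty.T F‖ ^ m * (‖z / CInfty.T F ^ m‖ / ‖lam 0‖ * ‖z / CInfty.T F ^ m‖) := by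
          gcongr
          exact h.norm_latticeExp_sub_le hΛ.isLattice hm
      _ = ‖z / CInfty.T F ^ m‖ * (‖z‖ / ‖lam 0‖) := by
          simp only [norm_div, norm_pow]
          field_simp
  obtain ⟨ρ, hρ, hle⟩ := φ.exists_norm_aeval_operatorTPow_le
  rw [tendsto_iff_norm_sub_tendsto_zero]
  refine squeeze_zero' (.of_forall fun m => norm_nonneg _) ?_ hd
  filter_upwards [hd.eventually_le_const hρ] with m hm
  have hz : latticeExp Λ z = Polynomial.aeval (z / CInfty.T F ^ m) (φ.operatorTPow m) +
      Polynomial.aeval (d m) (φ.operatorTPow m) := by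
    rw [← φ.aeval_operatorTPow_add, add_sub_cancel, ← hΛ.latticeExp_T_pow_mul,
      mul_div_cancel₀ z (pow_ne_zero m (CInfty.T_ne_zero F))]
  rw [norm_sub_rev, hz, add_sub_cancel_left]
  exact hle m _ hm

theorem latticeExp_add (hΛ : IsPeriodLattice φ Λ) (h : IsSuccessiveMinimumBasis Λ lam)
    (x y : CInfty F) : latticeExp Λ (x + y) = latticeExp Λ x + latticeExp Λ y := by
  refine tendsto_nhds_unique (hΛ.tendsto_latticeExp h (x + y)) ?_
  simp only [add_div, φ.aeval_operatorTPow_add]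
  exact (hΛ.tendsto_latticeExp h x).add (hΛ.tendsto_latticeExp h y)

theorem latticeExp_mem (hΛ : IsPeriodLattice φ Λ) (h : IsSuccessiveMinimumBasis Λ lam)
    {E : IntermediateField L (CInfty F)} (hE : IsClosed (E : Set (CInfty F))) {z : CInfty F}
    (hz : z ∈ E) : latticeExp Λ z ∈ E := by
  have hT : CInfty.T F ∈ E := E.algebraMap_mem (algebraMap (KInfty F) L (T F))
  exact hE.mem_of_tendsto (hΛ.tendsto_latticeExp h z) <| .of_forall fun m =>
    Polynomial.coe_aeval_mk_apply (S := E.toSubalgebra) _ (E.div_mem hz (pow_mem hT m)) ▸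
      SetLike.coe_mem _

theorem algHom_apply_mem (hΛ : IsPeriodLattice φ Λ) (h : IsSuccessiveMinimumBasis Λ lam)
    {E : IntermediateField L (CInfty F)} {σ : E →ₐ[L] CInfty F}
    (hσ : ∀ x, ‖σ x‖ = ‖(x : CInfty F)‖) {x : E} (hx : (x : CInfty F) ∈ Λ) : σ x ∈ Λ := by
  let θ : E := algebraMap L E (algebraMap (KInfty F) L (T F))
  have hnorm (m : ℕ) : ‖Polynomial.aeval (σ x / CInfty.T F ^ m) (φ.operatorTPow m)‖ =
      ‖Polynomial.aeval (x / CInfty.T F ^ m : CInfty F) (φ.operatorTPow m)‖ := by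
    have hC : (x / CInfty.T F ^ m : CInfty F) = E.val (x / θ ^ m) := rfl
    have hσC : σ x / CInfty.T F ^ m = σ (x / θ ^ m) := by
      rw [map_div₀, map_pow, σ.commutes]
      rfl
    rw [hC, hσC, Polynomial.aeval_algHom_apply, Polynomial.aeval_algHom_apply, hσ]
    rfl
  refine h.mem_of_latticeExp_eq_zero hΛ.isLattice (norm_eq_zero.1 ?_)
  refine tendsto_nhds_unique (hΛ.tendsto_latticeExp h (σ x)).norm ?_
  simpa only [hnorm, latticeExp_of_mem hx, norm_zero] using (hΛ.tendsto_latticeExp h x).norm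

end IsPeriodLattice

/-! ### The Galois extension `L(Λ) / L` -/

theorem mem_of_map_mem_of_norm_map_sub_le {M : Type*} [SeminormedAddCommGroup M]
    {H : AddSubgroup M} (hH : IsClosed (H : Set M)) {f : M →+ M} {c ρ : ℝ} (hc0 : 0 ≤ c)
    (hc1 : c < 1) (hf : ∀ x, ‖x‖ ≤ ρ → ‖f x - x‖ ≤ c * ‖x‖) (hfH : ∀ x ∈ H, f x ∈ H) {z : M}
    (hz : ‖z‖ ≤ ρ) (hfz : f z ∈ H) : z ∈ H := by
  let u : ℕ → M := fun n => (fun x => x - f x)^[n] z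
  have hu (n : ℕ) : u (n + 1) = u n - f (u n) := Function.iterate_succ_apply' _ _ _
  have hnorm (n : ℕ) : ‖u n‖ ≤ c ^ n * ‖z‖ := by
    induction n with
    | zero => simp [u]
    | succ n ih =>
      have hle : ‖u n‖ ≤ ρ :=
        (ih.trans (mul_le_of_le_one_left (norm_nonneg z) (pow_le_one₀ hc0 hc1.le))).trans hz
      rw [hu, norm_sub_rev, pow_succ', mul_assoc]
      exact (hf _ hle).trans (mul_le_mul_of_nonneg_left ih hc0)
  have hmem (n : ℕ) : z - u n ∈ H := by
    induction n with
    | zero => simp [u]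
    | succ n ih =>
      have hsplit : z - u (n + 1) = z - u n + (f z - f (z - u n)) := by
        rw [hu, map_sub]
        abel
      rw [hsplit]
      exact H.add_mem ih (H.sub_mem hfz (hfH _ ih))
  have hlim : Tendsto (fun n => z - u n) atTop (𝓝 (z - 0)) := by
    refine tendsto_const_nhds.sub (squeeze_zero_norm hnorm ?_)
    simpa using (tendsto_pow_atTop_nhds_zero_of_lt_one hc0 hc1).mul_const ‖z‖
  rw [sub_zero] at hlim
  exact hH.mem_of_tendsto hlim (.of_forall hmem)

theorem algHom_apply_mem_adjoin {K Ω : Type*} [Field K] [Field Ω] [Algebra K Ω] {S : Set Ω}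
    {σ : IntermediateField.adjoin K S →ₐ[K] Ω}
    (hσ : ∀ x : IntermediateField.adjoin K S, (x : Ω) ∈ S → σ x ∈ S)
    (x : IntermediateField.adjoin K S) : σ x ∈ IntermediateField.adjoin K S := by
  obtain ⟨x, hx⟩ := x
  induction hx using IntermediateField.adjoin_induction with
  | mem x hx => exact IntermediateField.subset_adjoin K S (hσ ⟨x, _⟩ hx)
  | algebraMap a => exact (σ.commutes a).symm ▸ IntermediateField.algebraMap_mem _ a
  | add x y hx hy ihx ihy => exact (map_add σ ⟨x, hx⟩ ⟨y, hy⟩).symm ▸ add_mem ihx ihy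
  | inv x hx ih => exact (map_inv₀ σ ⟨x, hx⟩).symm ▸ inv_mem ih
  | mul x y hx hy ihx ihy => exact (map_mul σ ⟨x, hx⟩ ⟨y, hy⟩).symm ▸ mul_mem ihx ihy

theorem normal_of_forall_algHom_apply_mem {K Ω : Type*} [Field K] [Field Ω] [Algebra K Ω]
    {E : IntermediateField K Ω} [Algebra.IsAlgebraic K E]
    (hsplits : ∀ x : E, ((minpoly K x).map (algebraMap K Ω)).Splits)
    (hE : ∀ (σ : E →ₐ[K] Ω) (x : E), σ x ∈ E) : Normal K E := by
  refine normal_iff.2 fun x => ⟨Algebra.IsIntegral.isIntegral x, ?_⟩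
  refine (IntermediateField.splits_iff_mem (hsplits x)).2 fun y hy => ?_
  obtain ⟨σ, rfl⟩ := IntermediateField.exists_algHom_of_splits_of_aeval
    (fun s => ⟨Algebra.IsIntegral.isIntegral s, hsplits s⟩)
    (Polynomial.aeval_eq_zero_of_mem_rootSet hy)
  exact hE σ x

section IntermediateFields

variable {F : Type*} [Field F] [Fintype F]

theorem splits_minpoly_map_KInfty {E : Type*} [Field E] [Algebra (KInfty F) E] (x : E) :
    ((minpoly (KInfty F) x).map (algebraMap (KInfty F) (CInfty F))).Splits := by
  let ι : AlgebraicClosure (KInfty F) →+* CInfty F := UniformSpace.Completion.coeRingHom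
  have hι : algebraMap (KInfty F) (CInfty F) = ι.comp (algebraMap _ _) := rfl
  rw [hι, ← Polynomial.map_map]
  exact (IsAlgClosed.splits _).map ι

variable {L : IntermediateField (KInfty F) (CInfty F)} {E : IntermediateField L (CInfty F)}

instance : IsScalarTower F[X] L (CInfty F) := .of_algebraMap_eq fun _ => rfl

instance : IsScalarTower (KInfty F) E (CInfty F) := .of_algebraMap_eq fun _ => rfl

theorem splits_minpoly_map [Algebra.IsIntegral (KInfty F) E] (x : E) :
    ((minpoly L x).map (algebraMap L (CInfty F))).Splits := by
  have hmap := splits_minpoly_map_KInfty (F := F) x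
  rw [IsScalarTower.algebraMap_eq (KInfty F) L (CInfty F), ← Polynomial.map_map] at hmap
  refine hmap.of_dvd (Polynomial.map_ne_zero (Polynomial.map_ne_zero ?_))
    (Polynomial.map_dvd _ (minpoly.dvd_map_of_isScalarTower (KInfty F) L x))
  exact minpoly.ne_zero (Algebra.IsIntegral.isIntegral x)

variable [FiniteDimensional (KInfty F) L] (E) [FiniteDimensional L E]

theorem finiteDimensional_KInfty : FiniteDimensional (KInfty F) E :=
  FiniteDimensional.trans (KInfty F) L E

theorem isClosed_intermediateField : IsClosed (E : Set (CInfty F)) := by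
  have : FiniteDimensional (KInfty F) (E.restrictScalars (KInfty F)).toSubmodule :=
    finiteDimensional_KInfty E
  exact Submodule.closed_of_finiteDimensional (E.restrictScalars (KInfty F)).toSubmodule

variable {E}

theorem norm_algHom_apply (σ : E →ₐ[L] CInfty F) (x : E) : ‖σ x‖ = ‖(x : CInfty F)‖ := by
  have := finiteDimensional_KInfty E
  rw [← AlgHom.restrictScalars_apply (KInfty F) σ, norm_algHom_eq_spectralNorm]
  exact (norm_algHom_eq_spectralNorm (IsScalarTower.toAlgHom (KInfty F) E (CInfty F)) x).symm

end IntermediateFields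

section PeriodField

variable {F : Type*} [Field F] [Fintype F] {L : IntermediateField (KInfty F) (CInfty F)} {r : ℕ}
  {φ : DrinfeldModule L r} {Λ : Submodule F[X] (CInfty F)} {lam : Fin r → CInfty F}

namespace IsPeriodLattice

/- For `m` large, `λ / T^m` is small and `e_Λ` maps it to a root `y` of the separable polynomial
`φ_{T^m}`; as `e_Λ` is close to the identity near `0` and preserves the complete field `L(y)`,
that field contains `λ / T^m`. -/
theorem isSeparable_of_mem [NeZero r] [FiniteDimensional (KInfty F) L] (hΛ : IsPeriodLattice φ Λ)
    (h : IsSuccessiveMinimumBasis Λ lam) {z : CInfty F} (hz : z ∈ Λ) : IsSeparable L z := by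
  have hpos : 0 < ‖lam 0‖ := norm_pos_iff.2 (h.ne_zero 0)
  obtain ⟨m, hm⟩ := ((CInfty.tendsto_div_T_pow F z).norm.eventually_le_const
    (show ‖(0 : CInfty F)‖ < ‖lam 0‖ / 2 by simpa using hpos)).exists
  have hTm := pow_ne_zero m (CInfty.T_ne_zero F)
  set y := latticeExp Λ (z / CInfty.T F ^ m)
  have hroot : Polynomial.aeval y (φ.operatorTPow m) = 0 := by
    rw [← hΛ.latticeExp_T_pow_mul, mul_div_cancel₀ z hTm, latticeExp_of_mem hz]
  have hy : IsSeparable L y := (φ.separable_operatorTPow m).of_dvd (minpoly.dvd L y hroot)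
  have : FiniteDimensional L (IntermediateField.adjoin L {y}) :=
    IntermediateField.adjoin.finiteDimensional hy.isIntegral
  have : Algebra.IsSeparable L (IntermediateField.adjoin L {y}) :=
    (IntermediateField.isSeparable_adjoin_simple_iff_isSeparable L _).2 hy
  have hclosed := isClosed_intermediateField (IntermediateField.adjoin L {y})
  have hdiv : z / CInfty.T F ^ m ∈ IntermediateField.adjoin L {y} := by
    refine mem_of_map_mem_of_norm_map_sub_le (c := 1 / 2)
      (H := (IntermediateField.adjoin L {y}).toSubfield.toAddSubgroup) hclosed
      (f := AddMonoidHom.mk' (latticeExp Λ) (hΛ.latticeExp_add h)) (by norm_num) (by norm_num)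
      (fun x hx => (h.norm_latticeExp_sub_le hΛ.isLattice (by linarith)).trans ?_)
      (fun x hx => hΛ.latticeExp_mem h hclosed hx) hm
      (IntermediateField.mem_adjoin_simple_self L y)
    refine mul_le_mul_of_nonneg_right ?_ (norm_nonneg x)
    rw [div_le_iff₀ hpos]
    linarith
  have hT : CInfty.T F ∈ IntermediateField.adjoin L {y} :=
    IntermediateField.algebraMap_mem _ (algebraMap (KInfty F) L (T F))
  refine IntermediateField.isSeparable_of_mem_isSeparable L (CInfty F)
    (L := IntermediateField.adjoin L {y}) ?_
  rw [← mul_div_cancel₀ z hTm]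
  exact mul_mem (pow_mem hT m) hdiv

end IsPeriodLattice

theorem IsSuccessiveMinimumBasis.periodField_eq_adjoin (h : IsSuccessiveMinimumBasis Λ lam)
    (hΛ : IsLattice r Λ) (L : IntermediateField (KInfty F) (CInfty F)) :
    periodField L Λ = IntermediateField.adjoin L (Set.range lam) := by
  refine le_antisymm (IntermediateField.adjoin_le_iff.2 fun z hz => ?_)
    (IntermediateField.adjoin.mono L _ _ (Set.range_subset_iff.2 h.mem))
  obtain ⟨a, rfl⟩ := h.exists_eq_sum hΛ hz
  exact sum_mem fun i _ => ((a i) • (⟨lam i, IntermediateField.subset_adjoin L _ ⟨i, rfl⟩⟩ :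
    IntermediateField.adjoin L (Set.range lam))).2

namespace IsPeriodLattice

variable [NeZero r] [FiniteDimensional (KInfty F) L]

theorem finiteDimensional_periodField (hΛ : IsPeriodLattice φ Λ)
    (h : IsSuccessiveMinimumBasis Λ lam) : FiniteDimensional L (periodField L Λ) := by
  rw [h.periodField_eq_adjoin hΛ.isLattice]
  refine IntermediateField.finiteDimensional_adjoin ?_
  rintro _ ⟨i, rfl⟩
  exact (hΛ.isSeparable_of_mem h (h.mem i)).isIntegral

theorem isGalois_periodField (hΛ : IsPeriodLattice φ Λ) (h : IsSuccessiveMinimumBasis Λ lam) :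
    IsGalois L (periodField L Λ) := by
  have := hΛ.finiteDimensional_periodField h
  have := finiteDimensional_KInfty (periodField L Λ)
  have : Algebra.IsSeparable L (periodField L Λ) :=
    (IntermediateField.isSeparable_adjoin_iff_isSeparable L (CInfty F)).2 fun z hz =>
      hΛ.isSeparable_of_mem h hz
  have : Normal L (periodField L Λ) := by
    refine normal_of_forall_algHom_apply_mem splits_minpoly_map fun σ => ?_
    exact algHom_apply_mem_adjoin fun x hx => hΛ.algHom_apply_mem h (norm_algHom_apply σ) hx
  exact {}

end IsPeriodLattice

end PeriodField

/-! ### Orders of block triangular matrices -/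

section BlockTriangular

theorem toSquareBlock_one {m R α : Type*} [DecidableEq m] [CommRing R] {b : m → α} (k : α) :
    (1 : Matrix m m R).toSquareBlock b k = 1 :=
  Matrix.submatrix_one _ Subtype.val_injective

variable {m R : Type*} [Fintype m] [CommRing R]

section LinearOrder

variable {α : Type*} [LinearOrder α] {b : m → α} {A B : Matrix m m R}

theorem toSquareBlock_mul (hA : A.BlockTriangular b) (hB : B.BlockTriangular b) (k : α) :
    (A * B).toSquareBlock b k = A.toSquareBlock b k * B.toSquareBlock b k := by
  refine (Matrix.toBlock_mul_eq_add _ (fun i => b i = k) _ A B).trans (add_eq_left.2 ?_)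
  ext i j
  refine Finset.sum_eq_zero fun l _ => ?_
  rcases lt_or_gt_of_ne l.2 with hlt | hgt
  · exact mul_eq_zero_of_left (hA (hlt.trans_eq i.2.symm)) _
  · exact mul_eq_zero_of_right _ (hB (j.2.trans_lt hgt))

variable [DecidableEq m]

theorem toSquareBlock_pow (hA : A.BlockTriangular b) (k : α) (n : ℕ) :
    (A ^ n).toSquareBlock b k = A.toSquareBlock b k ^ n := by
  induction n with
  | zero => rw [pow_zero, pow_zero, toSquareBlock_one]
  | succ n ih => rw [pow_succ, pow_succ, toSquareBlock_mul (hA.pow n) hA, ih]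

theorem isOfFinOrder_toSquareBlock (hA : A.BlockTriangular b) (hfin : IsOfFinOrder A) (k : α) :
    IsOfFinOrder (A.toSquareBlock b k) := by
  obtain ⟨n, hn, hAn⟩ := isOfFinOrder_iff_pow_eq_one.1 hfin
  refine isOfFinOrder_iff_pow_eq_one.2 ⟨n, hn, ?_⟩
  rw [← toSquareBlock_pow hA, hAn, toSquareBlock_one]

end LinearOrder

variable [DecidableEq m] {t : ℕ} {b : m → Fin t} {A : Matrix m m R}

theorem pow_apply_eq_zero_of_lt_add {N : Matrix m m R} (hN : ∀ i j, b j ≤ b i → N i j = 0)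
    (k : ℕ) {i j : m} (hij : (b j : ℕ) < b i + k) : (N ^ k) i j = 0 := by
  induction k generalizing j with
  | zero => exact Matrix.blockTriangular_one (Fin.lt_def.2 hij)
  | succ k ih =>
    rw [pow_succ, Matrix.mul_apply]
    refine Finset.sum_eq_zero fun l _ => ?_
    rcases le_or_gt (b j) (b l) with hjl | hlj
    · rw [hN l j hjl, mul_zero]
    · have hli : (b l : ℕ) < b i + k := by lia
      rw [ih hli, zero_mul]

theorem pow_eq_zero_of_forall_le {N : Matrix m m R} (hN : ∀ i j, b j ≤ b i → N i j = 0) :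
    N ^ t = 0 := by
  ext i j
  exact pow_apply_eq_zero_of_lt_add hN t (by lia)

theorem pow_char_pow_eq_one_of_toSquareBlock_eq_one (p : ℕ) [Fact p.Prime] [CharP R p]
    (hA : A.BlockTriangular b) (hdiag : ∀ τ, A.toSquareBlock b τ = 1) : A ^ p ^ (t - 1) = 1 := by
  rcases isEmpty_or_nonempty m with _ | _
  · exact Subsingleton.elim _ _
  have hnil : (A - 1) ^ t = 0 := by
    refine pow_eq_zero_of_forall_le (b := b) fun i j hji => ?_
    rcases hji.lt_or_eq with hlt | heq
    · rw [Matrix.sub_apply, hA hlt, Matrix.blockTriangular_one hlt, sub_zero]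
    · have hij := congrFun₂ ((hdiag (b i)).trans (toSquareBlock_one (b i)).symm) ⟨i, rfl⟩ ⟨j, heq⟩
      exact sub_eq_zero.2 hij
  have hle : t ≤ p ^ (t - 1) := by
    have := Nat.lt_pow_self (Fact.out : p.Prime).one_lt (n := t - 1)
    lia
  have hsub := sub_pow_char_pow_of_commute p (t - 1) (.one_right A)
  rw [pow_eq_zero_of_le hle hnil, one_pow] at hsub
  exact sub_eq_zero.1 hsub.symm

theorem orderOf_le_of_blockTriangular (p : ℕ) [Fact p.Prime] [CharP R p]
    (hA : A.BlockTriangular b) (hfin : IsOfFinOrder A) :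
    orderOf A ≤ (∏ τ, orderOf (A.toSquareBlock b τ)) * p ^ (t - 1) := by
  refine orderOf_le_of_pow_eq_one ?_ ?_
  · refine Nat.mul_pos (Finset.prod_pos fun τ _ => ?_) (pow_pos (Fact.out : p.Prime).pos _)
    exact orderOf_pos_iff.2 (isOfFinOrder_toSquareBlock hA hfin τ)
  · rw [pow_mul]
    refine pow_char_pow_eq_one_of_toSquareBlock_eq_one p (hA.pow _) fun τ => ?_
    rw [toSquareBlock_pow hA, ← orderOf_dvd_iff_pow_eq_one]
    exact Finset.dvd_prod_of_mem _ (Finset.mem_univ τ)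

end BlockTriangular

section FiniteField

variable {F : Type*} [Field F] [Fintype F]

theorem orderOf_lt_card_pow_natDegree_minpoly {S : Type*} [Ring S] [Nontrivial S] [Algebra F S]
    {x : S} (hx : IsIntegral F x) : orderOf x < Fintype.card F ^ (minpoly F x).natDegree := by
  let pb := AdjoinRoot.powerBasis' (minpoly.monic hx)
  have := pb.finite
  have : Finite (AdjoinRoot (minpoly F x)) := Module.finite_of_finite F
  have : Nontrivial (AdjoinRoot (minpoly F x)) :=
    AdjoinRoot.nontrivial _ (minpoly.degree_pos hx).ne'
  have hroot : orderOf x = orderOf (AdjoinRoot.root (minpoly F x)) := by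
    refine orderOf_eq_orderOf_iff.2 fun n => ?_
    rw [← sub_eq_zero, ← sub_eq_zero (a := _ ^ n), ← AdjoinRoot.mk_X, ← map_pow,
      ← map_one (AdjoinRoot.mk _), ← map_sub, AdjoinRoot.mk_eq_zero, minpoly.dvd_iff, map_sub,
      map_pow, Polynomial.aeval_X, map_one]
  have hcard : Nat.card (AdjoinRoot (minpoly F x)) = Fintype.card F ^ (minpoly F x).natDegree := by
    rw [Module.natCard_eq_pow_finrank (K := F), pb.finrank, Nat.card_eq_fintype_card]
    rfl
  rw [hroot, ← hcard]
  exact orderOf_lt_card _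

theorem orderOf_matrix_lt {n : Type*} [Fintype n] [DecidableEq n] [Nonempty n]
    (D : Matrix n n F) : orderOf D < Fintype.card F ^ Fintype.card n := by
  refine (orderOf_lt_card_pow_natDegree_minpoly (Matrix.isIntegral D)).trans_le ?_
  refine Nat.pow_le_pow_right Fintype.card_pos ?_
  rw [← D.charpoly_natDegree_eq_dim]
  exact Polynomial.natDegree_le_of_dvd D.minpoly_dvd_charpoly D.charpoly_monic.ne_zero

theorem orderOf_matrix_polynomial_lt {n : Type*} [Fintype n] [DecidableEq n] [Nonempty n]
    {M : Matrix n n F[X]} (hM : ∀ i j, ∃ c, M i j = Polynomial.C c) :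
    orderOf M < Fintype.card F ^ Fintype.card n := by
  choose D hD using hM
  let ι : Matrix n n F →* Matrix n n F[X] :=
    ((Polynomial.C (R := F)).mapMatrix : Matrix n n F →+* Matrix n n F[X])
  have hι : Function.Injective ι := Matrix.map_injective Polynomial.C_injective
  have hDM : ι (.of D) = M := by
    ext1 i j
    exact (hD i j).symm
  rw [← hDM, orderOf_injective ι hι]
  exact orderOf_matrix_lt _

end FiniteField

section Packets

variable {F : Type*} [Field F] [Fintype F] {r t : ℕ} {lam : Fin r → CInfty F}
  {B : Fin t → Finset (Fin r)}

namespace IsPacketSplitting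

/-- The index of the packet that contains `lam i`. -/
def index (h : IsPacketSplitting lam B) (i : Fin r) : Fin t := (h.exists_mem i).choose

theorem mem_iff_index_eq (h : IsPacketSplitting lam B) {i : Fin r} {τ : Fin t} :
    i ∈ B τ ↔ h.index i = τ := by
  have hi : i ∈ B (h.index i) := (h.exists_mem i).choose_spec
  refine ⟨fun hτ => ?_, fun hτ => hτ ▸ hi⟩
  refine le_antisymm (not_lt.1 fun hlt => ?_) (not_lt.1 fun hlt => ?_)
  · exact (h.norm_lt _ _ hlt i hτ i hi).false
  · exact (h.norm_lt _ _ hlt i hi i hτ).false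

theorem mem_index (h : IsPacketSplitting lam B) (i : Fin r) : i ∈ B (h.index i) :=
  h.mem_iff_index_eq.2 rfl

theorem card_subtype_index (h : IsPacketSplitting lam B) (τ : Fin t) :
    Fintype.card {i // h.index i = τ} = (B τ).card :=
  Fintype.card_of_subtype (B τ) fun _ => h.mem_iff_index_eq

theorem sum_card (h : IsPacketSplitting lam B) : ∑ τ, (B τ).card = r := by
  have hfiber := Fintype.sum_fiberwise h.index fun _ => 1
  simpa [h.card_subtype_index] using hfiber

theorem le_rank (h : IsPacketSplitting lam B) : t ≤ r := by
  simpa [h.sum_card] using Finset.card_nsmul_le_sum Finset.univ (fun τ => (B τ).card) 1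
    fun τ _ => (h.nonempty τ).card_pos

theorem prod_card_pow_sub_one_le (h : IsPacketSplitting lam B) (hr : 0 < r) :
    ∏ τ, (Fintype.card F ^ (B τ).card - 1) ≤ Fintype.card F ^ r - 1 := by
  have hprod : Fintype.card F ^ r = ∏ τ, Fintype.card F ^ (B τ).card := by
    rw [Finset.prod_pow_eq_pow_sum, h.sum_card]
  refine Nat.le_sub_of_add_le (LE.le.trans ?_ hprod.ge)
  have hpos (τ : Fin t) : 1 ≤ Fintype.card F ^ (B τ).card := Nat.one_le_pow _ _ Fintype.card_pos
  simpa using Finset.prod_add_prod_le' (Finset.mem_univ (h.index ⟨0, hr⟩))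
    (Nat.sub_add_cancel (hpos _)).le (fun τ _ _ => Nat.sub_le _ 1) fun τ _ _ => hpos τ

end IsPacketSplitting

end Packets

namespace IsSuccessiveMinimumBasis

variable {F : Type*} [Field F] [Fintype F] {r : ℕ} {Λ : Submodule F[X] (CInfty F)}
  {lam : Fin r → CInfty F}

/-- A successive minimum basis, as a basis of the `A`-module `Λ`. -/
def basis (h : IsSuccessiveMinimumBasis Λ lam) (hΛ : IsLattice r Λ) :
    Module.Basis (Fin r) F[X] Λ :=
  (Module.Basis.span h.linearIndependent).map (.ofEq _ _ (h.span_eq hΛ))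

theorem coe_basis_apply (h : IsSuccessiveMinimumBasis Λ lam) (hΛ : IsLattice r Λ) (i : Fin r) :
    (h.basis hΛ i : CInfty F) = lam i := by
  simp only [basis, Module.Basis.map_apply, LinearEquiv.coe_ofEq_apply, Module.Basis.span_apply]

section Contraction

variable {f : Module.End F[X] Λ}

theorem norm_toMatrix_smul_le (h : IsSuccessiveMinimumBasis Λ lam) (hΛ : IsLattice r Λ)
    (hf : ∀ x, ‖(f x : CInfty F)‖ ≤ ‖(x : CInfty F)‖) (i j : Fin r) :
    ‖LinearMap.toMatrixAlgEquiv (h.basis hΛ) f i j • lam i‖ ≤ ‖lam j‖ := by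
  let b := h.basis hΛ
  have hsum := congrArg Λ.subtype (b.sum_repr (f (b j)))
  simp only [map_sum, map_smul, Submodule.subtype_apply, b, coe_basis_apply] at hsum
  have hle := h.norm_smul_le_norm_sum (b.repr (f (b j))) (Finset.mem_univ i)
  rw [hsum] at hle
  rw [LinearMap.toMatrixAlgEquiv_apply]
  exact hle.trans ((hf _).trans_eq (by rw [h.coe_basis_apply]))

theorem toMatrix_apply_eq_zero (h : IsSuccessiveMinimumBasis Λ lam) (hΛ : IsLattice r Λ)
    (hf : ∀ x, ‖(f x : CInfty F)‖ ≤ ‖(x : CInfty F)‖) {i j : Fin r} (hij : ‖lam j‖ < ‖lam i‖) :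
    LinearMap.toMatrixAlgEquiv (h.basis hΛ) f i j = 0 := by
  by_contra hne
  have hle := h.norm_toMatrix_smul_le hΛ hf i j
  exact hle.not_gt (hij.trans_le (norm_le_norm_smul hne _))

theorem exists_toMatrix_apply_eq_C (h : IsSuccessiveMinimumBasis Λ lam) (hΛ : IsLattice r Λ)
    (hf : ∀ x, ‖(f x : CInfty F)‖ ≤ ‖(x : CInfty F)‖) {i j : Fin r} (hij : ‖lam j‖ = ‖lam i‖) :
    ∃ c, LinearMap.toMatrixAlgEquiv (h.basis hΛ) f i j = Polynomial.C c := by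
  have hle := h.norm_toMatrix_smul_le hΛ hf i j
  refine ⟨_, Polynomial.eq_C_of_degree_le_zero (not_lt.1 fun hdeg => hle.not_gt ?_)⟩
  rw [← Polynomial.degree_one (R := F)] at hdeg
  simpa [hij] using norm_smul_lt_norm_smul hdeg hij.le (h.ne_zero i)

theorem orderOf_le_of_norm_le (h : IsSuccessiveMinimumBasis Λ lam) (hΛ : IsLattice r Λ)
    (p : ℕ) [CharP F p] {t : ℕ} {B : Fin t → Finset (Fin r)} (hB : IsPacketSplitting lam B)
    (hf : ∀ x, ‖(f x : CInfty F)‖ ≤ ‖(x : CInfty F)‖) (hfin : IsOfFinOrder f) :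
    orderOf f ≤ (∏ τ, (Fintype.card F ^ (B τ).card - 1)) * p ^ (t - 1) := by
  have : Fact p.Prime := ⟨CharP.char_is_prime F p⟩
  set A := LinearMap.toMatrixAlgEquiv (h.basis hΛ) f
  have hfA : orderOf A = orderOf f :=
    (LinearMap.toMatrixAlgEquiv (h.basis hΛ)).toMulEquiv.orderOf_eq f
  have hA : A.BlockTriangular hB.index := fun i j hij =>
    h.toMatrix_apply_eq_zero hΛ hf (hB.norm_lt _ _ hij j (hB.mem_index j) i (hB.mem_index i))
  have hdiag (τ : Fin t) :
      orderOf (A.toSquareBlock hB.index τ) ≤ Fintype.card F ^ (B τ).card - 1 := by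
    obtain ⟨i, hi⟩ := hB.nonempty τ
    have : Nonempty {i // hB.index i = τ} := ⟨⟨i, hB.mem_iff_index_eq.1 hi⟩⟩
    rw [← hB.card_subtype_index]
    exact Nat.le_sub_one_of_lt <| orderOf_matrix_polynomial_lt fun i j =>
      h.exists_toMatrix_apply_eq_C hΛ hf <| hB.norm_eq τ j (hB.mem_iff_index_eq.2 j.2)
        i (hB.mem_iff_index_eq.2 i.2)
  have hAfin : IsOfFinOrder A := orderOf_pos_iff.1 (hfA ▸ hfin.orderOf_pos)
  rw [← hfA]
  exact (orderOf_le_of_blockTriangular p hA hAfin).trans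
    (Nat.mul_le_mul_right _ (Finset.prod_le_prod' fun τ _ => hdiag τ))

end Contraction

end IsSuccessiveMinimumBasis

/-! ### The Galois representation on the period lattice -/

theorem mem_periodField {F : Type*} [Field F] [Fintype F]
    (L : IntermediateField (KInfty F) (CInfty F)) {Λ : Submodule F[X] (CInfty F)} {z : CInfty F}
    (hz : z ∈ Λ) : z ∈ periodField L Λ :=
  IntermediateField.subset_adjoin L _ hz

namespace IsPeriodLattice

variable {F : Type*} [Field F] [Fintype F] {L : IntermediateField (KInfty F) (CInfty F)} {r : ℕ}
  [NeZero r] [FiniteDimensional (KInfty F) L] {φ : DrinfeldModule L r}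
  {Λ : Submodule F[X] (CInfty F)} {lam : Fin r → CInfty F}

theorem algEquiv_apply_mem (hΛ : IsPeriodLattice φ Λ) (h : IsSuccessiveMinimumBasis Λ lam)
    (σ : Gal(periodField L Λ/L)) {x : periodField L Λ} (hx : (x : CInfty F) ∈ Λ) :
    (σ x : CInfty F) ∈ Λ :=
  have := hΛ.finiteDimensional_periodField h
  hΛ.algHom_apply_mem h (norm_algHom_apply ((periodField L Λ).val.comp σ.toAlgHom)) hx

/-- The `A`-linear action of the Galois group of `L(Λ) / L` on the period lattice `Λ`. -/
def galoisRep (hΛ : IsPeriodLattice φ Λ) (h : IsSuccessiveMinimumBasis Λ lam) :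
    Gal(periodField L Λ/L) →* Module.End F[X] Λ where
  toFun σ :=
    { toFun := fun x => ⟨σ ⟨x, mem_periodField L x.2⟩, hΛ.algEquiv_apply_mem h σ x.2⟩
      map_add' := fun x y => by
        have key := map_add σ ⟨x, mem_periodField L x.2⟩ ⟨y, mem_periodField L y.2⟩
        exact Subtype.ext (congrArg (algebraMap _ (CInfty F)) key)
      map_smul' := fun a x => by
        have key := map_smul (σ.restrictScalars F[X]) a ⟨x, mem_periodField L x.2⟩
        exact Subtype.ext (congrArg (algebraMap _ (CInfty F)) key) }
  map_one' := rfl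
  map_mul' _ _ := rfl

theorem norm_galoisRep_apply (hΛ : IsPeriodLattice φ Λ) (h : IsSuccessiveMinimumBasis Λ lam)
    (σ : Gal(periodField L Λ/L)) (x : Λ) :
    ‖(hΛ.galoisRep h σ x : CInfty F)‖ = ‖(x : CInfty F)‖ :=
  have := hΛ.finiteDimensional_periodField h
  norm_algHom_apply ((periodField L Λ).val.comp σ.toAlgHom) ⟨x, mem_periodField L x.2⟩

theorem galoisRep_injective (hΛ : IsPeriodLattice φ Λ) (h : IsSuccessiveMinimumBasis Λ lam) :
    Function.Injective (hΛ.galoisRep h) := by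
  intro σ τ hστ
  refine AlgEquiv.coe_toAlgHom_injective ?_
  refine IntermediateField.algHom_ext_of_eq_adjoin L rfl fun x hx => Subtype.ext ?_
  exact congrArg (fun y : Λ => (y : CInfty F)) (LinearMap.congr_fun hστ ⟨x, hx⟩)

theorem orderOf_algEquiv_le (hΛ : IsPeriodLattice φ Λ) (h : IsSuccessiveMinimumBasis Λ lam) (p : ℕ)
    [CharP F p] {t : ℕ} {B : Fin t → Finset (Fin r)} (hB : IsPacketSplitting lam B)
    (σ : Gal(periodField L Λ/L)) :
    orderOf σ ≤ (∏ τ, (Fintype.card F ^ (B τ).card - 1)) * p ^ (t - 1) := by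
  have := hΛ.finiteDimensional_periodField h
  rw [← orderOf_injective _ (hΛ.galoisRep_injective h)]
  exact h.orderOf_le_of_norm_le hΛ.isLattice p hB (fun x => (hΛ.norm_galoisRep_apply h σ x).le)
    ((hΛ.galoisRep h).isOfFinOrder (isOfFinOrder_of_finite σ))

end IsPeriodLattice

/-! ### Residue fields and Frobenius lifts -/

theorem mem_maximalIdeal_valuationRing_iff {F : Type*} [Field F] [Fintype F] {E : Type*} [Field E]
    [Algebra E (CInfty F)] {x : valuationRing F E} :
    x ∈ IsLocalRing.maximalIdeal (valuationRing F E) ↔ ‖algebraMap E (CInfty F) x‖ < 1 := by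
  rw [← ValuationSubring.coe_mem_nonunits_iff, ValuationSubring.mem_nonunits_iff_or,
    mem_valuationRing, map_inv₀, norm_inv, not_le]
  rcases eq_or_ne (x : E) 0 with hx | hx
  · simp [hx]
  · simp only [hx, false_or]
    exact one_lt_inv₀ (norm_pos_iff.2 ((map_ne_zero (algebraMap E (CInfty F))).2 hx))

section ConstantApproximation

variable {F : Type*} [Field F]

theorem denseRange_algebraMap_ratFunc : DenseRange (algebraMap (RatFunc F) (KInfty F)) := by
  let _ : DecidableEq (RatFunc F) := Classical.decEq _
  let _ : UniformSpace (RatFunc F) := (RatFunc.inftyValued F).toUniformSpace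
  exact UniformSpace.Completion.denseRange_coe

variable [Fintype F]

theorem exists_norm_algebraMap_ratFunc_sub_lt_one (x : RatFunc F) :
    ∃ a : F[X], ‖algebraMap (RatFunc F) (KInfty F) x - algebraMap F[X] (KInfty F) a‖ < 1 := by
  obtain ⟨a, b, hb, rfl⟩ := IsFractionRing.div_surjective (A := F[X]) x
  replace hb : b ≠ 0 := nonZeroDivisors.ne_zero hb
  have hmod : ‖algebraMap F[X] (KInfty F) (a % b)‖ < ‖algebraMap F[X] (KInfty F) b‖ :=
    norm_map_lt_norm_map one_lt_norm_X_KInfty (EuclideanDomain.mod_lt a hb)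
  have hb' : algebraMap F[X] (KInfty F) b ≠ 0 := norm_pos_iff.1 ((norm_nonneg _).trans_lt hmod)
  refine ⟨a / b, ?_⟩
  have hsub : algebraMap (RatFunc F) (KInfty F) (algebraMap F[X] _ a / algebraMap F[X] _ b) -
      algebraMap F[X] (KInfty F) (a / b) =
      algebraMap F[X] (KInfty F) (a % b) / algebraMap F[X] (KInfty F) b := by
    rw [map_div₀, EuclideanDomain.mod_eq_sub_mul_div, map_sub, map_mul, sub_div,
      mul_div_cancel_left₀ _ hb']
    rfl
  rw [hsub, norm_div]
  exact (div_lt_one (norm_pos_iff.2 hb')).2 hmod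

theorem exists_norm_sub_algebraMap_lt_one (c : KInfty F) :
    ∃ a : F[X], ‖c - algebraMap F[X] (KInfty F) a‖ < 1 := by
  obtain ⟨x, hx⟩ := denseRange_algebraMap_ratFunc.exists_dist_lt c one_pos
  obtain ⟨a, ha⟩ := exists_norm_algebraMap_ratFunc_sub_lt_one x
  refine ⟨a, ?_⟩
  rw [← dist_eq_norm] at ha ⊢
  exact (IsUltrametricDist.dist_triangle_max _ _ _).trans_lt (max_lt hx ha)

theorem exists_norm_sub_C_lt_one {c : KInfty F} (hc : ‖c‖ ≤ 1) :
    ∃ f : F, ‖c - algebraMap F[X] (KInfty F) (Polynomial.C f)‖ < 1 := by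
  obtain ⟨a, ha⟩ := exists_norm_sub_algebraMap_lt_one c
  have ha1 : ‖algebraMap F[X] (KInfty F) a‖ ≤ 1 := by
    simpa using (norm_sub_le_max c (c - algebraMap F[X] (KInfty F) a)).trans (max_le hc ha.le)
  have hdeg : a.degree ≤ 0 := by
    contrapose! ha1
    simpa using norm_map_lt_norm_map one_lt_norm_X_KInfty (b := a) (a := 1) (by simpa using ha1)
  exact ⟨a.coeff 0, Polynomial.eq_C_of_degree_le_zero hdeg ▸ ha⟩

end ConstantApproximation

section ResidueField

variable {F : Type*} [Field F] [Fintype F] {E : Type*} [Field E] [Algebra E (CInfty F)]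
  [Algebra (KInfty F) E] [IsScalarTower (KInfty F) E (CInfty F)]

theorem algebraMap_C_mem_valuationRing (f : F) :
    algebraMap (KInfty F) E (algebraMap F[X] (KInfty F) (Polynomial.C f)) ∈ valuationRing F E := by
  rw [mem_valuationRing, ← IsScalarTower.algebraMap_apply, norm_algebraMap']
  exact norm_map_C_le_one _ f

/-- The valuation ring of an extension of `K_∞`, and hence its residue field, as an algebra over
the field of constants `𝔽`. -/
instance : Algebra F (valuationRing F E) :=
  (RingHom.codRestrict
    (((algebraMap (KInfty F) E).comp (algebraMap F[X] (KInfty F))).comp Polynomial.C)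
    (valuationRing F E) algebraMap_C_mem_valuationRing).toAlgebra

theorem norm_lt_one_of_sum_smul_eq_zero {ι : Type*} [Fintype ι] {u : ι → valuationRing F E}
    (hu : LinearIndependent F fun i => IsLocalRing.residue (valuationRing F E) (u i))
    {g : ι → KInfty F} (hg : ∀ i, ‖g i‖ ≤ 1) (hsum : ∑ i, g i • (u i : E) = 0) (i : ι) :
    ‖g i‖ < 1 := by
  choose f hf using fun i => exists_norm_sub_C_lt_one (hg i)
  have hcoe : ((∑ i, f i • u i : valuationRing F E) : E) =
      -∑ i, (g i - algebraMap F[X] (KInfty F) (Polynomial.C (f i))) • (u i : E) := by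
    simp only [sub_smul, Finset.sum_sub_distrib, hsum, zero_sub, neg_neg]
    simp only [Algebra.smul_def]
    push_cast
    rfl
  have hzero : ∑ i, f i • IsLocalRing.residue (valuationRing F E) (u i) = 0 := by
    have hmem : ∑ i, f i • u i ∈ IsLocalRing.maximalIdeal (valuationRing F E) := by
      rw [mem_maximalIdeal_valuationRing_iff, hcoe, map_neg, norm_neg, map_sum]
      refine norm_sum_lt_of_forall_lt one_pos fun i _ => ?_
      rw [Algebra.smul_def, map_mul, norm_mul, ← IsScalarTower.algebraMap_apply, norm_algebraMap']
      exact mul_lt_one_of_nonneg_of_lt_one_left (norm_nonneg _) (hf i)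
        ((mem_valuationRing F _).1 (u i).2)
    rw [← (IsLocalRing.residue_eq_zero_iff _).2 hmem, map_sum]
    rfl
  simpa [Fintype.linearIndependent_iff.1 hu f hzero i] using hf i

theorem linearIndependent_of_residue {ι : Type*} [Finite ι] {u : ι → valuationRing F E}
    (hu : LinearIndependent F fun i => IsLocalRing.residue (valuationRing F E) (u i)) :
    LinearIndependent (KInfty F) fun i => (u i : E) := by
  have := Fintype.ofFinite ι
  rw [Fintype.linearIndependent_iff]
  intro g hg i
  obtain ⟨j, -, hj⟩ := Finset.exists_max_image Finset.univ (fun i => ‖g i‖) ⟨i, Finset.mem_univ _⟩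
  suffices hgj : g j = 0 by simpa [hgj] using hj i (Finset.mem_univ _)
  by_contra hgj
  have hscaled : ∑ i, ((g j)⁻¹ * g i) • (u i : E) = 0 := by
    simp only [mul_smul, ← Finset.smul_sum, hg, smul_zero]
  have hlt := norm_lt_one_of_sum_smul_eq_zero hu (g := fun i => (g j)⁻¹ * g i) (fun i => by
    rw [norm_mul, norm_inv]
    exact inv_mul_le_one_of_le₀ (hj i (Finset.mem_univ _)) (norm_nonneg _)) hscaled j
  simp [inv_mul_cancel₀ hgj] at hlt

variable (F E) in
theorem finite_residueField [FiniteDimensional (KInfty F) E] :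
    Finite (IsLocalRing.ResidueField (valuationRing F E)) := by
  obtain ⟨lift, hlift⟩ := (IsLocalRing.residue_surjective (R := valuationRing F E)).hasRightInverse
  have hrank : Module.rank F (IsLocalRing.ResidueField (valuationRing F E)) ≤
      Module.finrank (KInfty F) E := by
    refine rank_le fun s hs => ?_
    have hind := linearIndependent_of_residue (u := fun i : s => lift i) (by simpa only [hlift _])
    simpa using hind.fintype_card_le_finrank
  have : Module.Finite F (IsLocalRing.ResidueField (valuationRing F E)) :=
    Module.rank_lt_aleph0_iff.1 (hrank.trans_lt Cardinal.natCast_lt_aleph0)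
  exact Module.finite_of_finite F

end ResidueField

section Frobenius

open scoped Pointwise

theorem frobenius_pow_mk {R S G : Type*} [CommRing R] [CommRing S] [Algebra R S] [Group G]
    [MulSemiringAction G S] [SMulCommClass G R S] {Q : Ideal S} {σ : G}
    (hσ : IsArithFrobAt R σ Q) (n : ℕ) (x : S) :
    Ideal.Quotient.mk Q (σ ^ n • x) = Ideal.Quotient.mk Q x ^ Nat.card (R ⧸ Q.under R) ^ n := by
  induction n with
  | zero => simp
  | succ n ih =>
    rw [pow_succ', mul_smul, pow_succ, pow_mul, ← ih]
    exact hσ.mk_apply _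

theorem inertiaDeg_dvd_orderOf {R S G : Type*} [CommRing R] [CommRing S] [Algebra R S] [Group G]
    [MulSemiringAction G S] [SMulCommClass G R S] {Q : Ideal S} [Q.IsPrime] [Finite (S ⧸ Q)]
    {σ : G} (hσ : IsArithFrobAt R σ Q) : Q.inertiaDeg R ∣ orderOf σ := by
  have : Finite (R ⧸ Q.under R) := hσ.finite_quotient
  have : Q.IsMaximal := Ideal.Quotient.maximal_of_isField _ (Finite.isField_of_domain (S ⧸ Q))
  have : (Q.under R).IsMaximal :=
    Ideal.Quotient.maximal_of_isField _ (Finite.isField_of_domain (R ⧸ Q.under R))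
  let _ : Field (R ⧸ Q.under R) := Ideal.Quotient.field _
  let _ : Field (S ⧸ Q) := Ideal.Quotient.field _
  have := Fintype.ofFinite (R ⧸ Q.under R)
  rw [Ideal.inertiaDeg_eq_of_isMaximal (Q.under R) Q,
    ← FiniteField.orderOf_frobeniusAlgHom (R ⧸ Q.under R) (S ⧸ Q)]
  refine orderOf_dvd_of_pow_eq_one (AlgHom.ext fun y => ?_)
  obtain ⟨x, rfl⟩ := Ideal.Quotient.mk_surjective y
  have hfix := frobenius_pow_mk hσ (orderOf σ) x
  rw [pow_orderOf_eq_one, one_smul, Nat.card_eq_fintype_card] at hfix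
  rw [AlgHom.coe_pow, FiniteField.coe_frobeniusAlgHom, pow_iterate]
  exact hfix.symm

variable {F : Type*} [Field F] [Fintype F] {L : IntermediateField (KInfty F) (CInfty F)}
  [FiniteDimensional (KInfty F) L] {E : IntermediateField L (CInfty F)} [FiniteDimensional L E]

theorem mem_decompositionSubgroup_valuationRing (σ : Gal(E/L)) :
    σ ∈ (valuationRing F E).decompositionSubgroup L := by
  have hle (τ : Gal(E/L)) : τ • valuationRing F E ≤ valuationRing F E := by
    rintro _ ⟨x, hx, rfl⟩
    exact (norm_algHom_apply (E.val.comp τ.toAlgHom) x).trans_le hx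
  exact MulAction.mem_stabilizer_iff.2
    ((hle σ).antisymm (ValuationSubring.subset_pointwise_smul_iff.2 (hle σ⁻¹)))

theorem exists_residueDegree_le_orderOf [IsGalois L E] :
    ∃ σ : Gal(E/L), residueDegree F L E ≤ orderOf σ := by
  let _ := valuationRingAlgebra F L E
  let D := (valuationRing F E).decompositionSubgroup L
  have : SMulCommClass D (valuationRing F L) (valuationRing F E) :=
    ⟨fun σ a x => Subtype.ext (map_smul (σ : Gal(E/L)) (a : L) (x : E))⟩
  have : Algebra.IsInvariant (valuationRing F L) (valuationRing F E) D := by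
    refine ⟨fun x hx => ?_⟩
    obtain ⟨a, ha⟩ := (IsGalois.mem_range_algebraMap_iff_fixed (F := L) (x : E)).2 fun σ =>
      congrArg Subtype.val (hx ⟨σ, mem_decompositionSubgroup_valuationRing σ⟩)
    exact ⟨⟨a, by rw [mem_valuationRing, IsScalarTower.algebraMap_apply L E, ha]; exact x.2⟩,
      Subtype.ext ha⟩
  have : FiniteDimensional (KInfty F) E := finiteDimensional_KInfty E
  have : Finite (valuationRing F E ⧸ IsLocalRing.maximalIdeal (valuationRing F E)) :=
    finite_residueField F E
  obtain ⟨σ, hσ⟩ := IsArithFrobAt.exists_of_isInvariant (valuationRing F L) D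
    (IsLocalRing.maximalIdeal (valuationRing F E))
  refine ⟨σ, Nat.le_of_dvd (orderOf_pos _) ?_⟩
  rw [Subgroup.orderOf_coe]
  exact inertiaDeg_dvd_orderOf hσ

end Frobenius

end DrinfeldPeriods

end

open DrinfeldPeriods in
theorem theorem4_general {F : Type*} [Field F] [Fintype F] (p : ℕ) [CharP F p]
    (L : IntermediateField (KInfty F) (CInfty F)) [FiniteDimensional (KInfty F) L]
    (r : ℕ) (hr : 0 < r) (φ : DrinfeldModule L r) (Λ : Submodule F[X] (CInfty F))
    (hΛ : IsPeriodLattice φ Λ) (lam : Fin r → CInfty F) (hlam : IsSuccessiveMinimumBasis Λ lam)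
    (t : ℕ) (B : Fin t → Finset (Fin r)) (hB : IsPacketSplitting lam B) :
    FiniteDimensional L (periodField L Λ) ∧
    residueDegree F L (periodField L Λ) ≤
      (∏ τ, (Fintype.card F ^ (B τ).card - 1)) * p ^ (t - 1) ∧
    residueDegree F L (periodField L Λ) ≤ (Fintype.card F ^ r - 1) * p ^ (t - 1) ∧
    residueDegree F L (periodField L Λ) ≤ (Fintype.card F ^ r - 1) * p ^ (r - 1) := by
  have : NeZero r := ⟨hr.ne'⟩
  have hp : 0 < p := (CharP.char_is_prime F p).pos
  have hfin : FiniteDimensional L (periodField L Λ) := hΛ.finiteDimensional_periodField hlam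
  have : IsGalois L (periodField L Λ) := hΛ.isGalois_periodField hlam
  obtain ⟨σ, hσ⟩ := exists_residueDegree_le_orderOf (E := periodField L Λ)
  have hf := hσ.trans (hΛ.orderOf_algEquiv_le hlam p hB σ)
  have hprod := hf.trans (Nat.mul_le_mul_right _ (hB.prod_card_pow_sub_one_le hr))
  exact ⟨hfin, hf, hprod, hprod.trans (Nat.mul_le_mul_left _
    (Nat.pow_le_pow_right hp (Nat.sub_le_sub_right hB.le_rank 1)))⟩

theorem theorem4 {F : Type*} [Field F] [Fintype F] (p : ℕ) [CharP F p]
    (L : IntermediateField (DrinfeldPeriods.KInfty F) (DrinfeldPeriods.CInfty F))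
    [FiniteDimensional (DrinfeldPeriods.KInfty F) L]
    (r : ℕ) (hr : 2 ≤ r) (φ : DrinfeldPeriods.DrinfeldModule L r)
    (Λ : Submodule (Polynomial F) (DrinfeldPeriods.CInfty F))
    (hΛ : DrinfeldPeriods.IsPeriodLattice φ Λ)
    (lam : Fin r → DrinfeldPeriods.CInfty F)
    (hlam : DrinfeldPeriods.IsSuccessiveMinimumBasis Λ lam)
    (t : ℕ) (B : Fin t → Finset (Fin r)) (hB : DrinfeldPeriods.IsPacketSplitting lam B) :
    FiniteDimensional L (DrinfeldPeriods.periodField L Λ) ∧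
    DrinfeldPeriods.residueDegree F L (DrinfeldPeriods.periodField L Λ) ≤
      (∏ τ : Fin t, (Fintype.card F ^ (B τ).card - 1)) * p ^ (t - 1) ∧
    DrinfeldPeriods.residueDegree F L (DrinfeldPeriods.periodField L Λ) ≤
      (Fintype.card F ^ r - 1) * p ^ (t - 1) ∧
    DrinfeldPeriods.residueDegree F L (DrinfeldPeriods.periodField L Λ) ≤
      (Fintype.card F ^ r - 1) * p ^ (r - 1) :=
  theorem4_general p L r (by omega) φ Λ hΛ lam hlam t B hB
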